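/- Let $\mathcal X,\mathcal A,\mathcal Y$ be finite sets, $P_X$ a pmf on $\mathcal X$, $P_{Y|X,A}$ a channel from $\mathcal X\times\mathcal A$ to $\mathcal Y$, and $\Lambda:\mathcal A\to\mathbb R$ a cost function. A $(2^{nR_X},2^{nR_Y},n)$ code with actions at encoder 1 consists of encoders $T_1:\mathcal X^n\to\{1,\dots,\lfloor 2^{nR_X}\rfloor\}$ and $T_2:\mathcal Y^n\to\{1,\dots,\lfloor 2^{nR_Y}\rfloor\}$, a strategy $h_e:\mathcal X^n\to\mathcal A^n$, and a decoder $g:\{1,\dots,\lfloor 2^{nR_X}\rfloor\}\times\{1,\dots,\lfloor 2^{nR_Y}\rfloor\}\to\mathcal X^n\times\mathcal Y^n$. The source $X^n$ is i.i.d. $\sim P_X$, $A^n=h_e(X^n)$, and $\Pr(Y^n=y^n\mid X^n=x^n,A^n=a^n)=\prod_{i=1}^n P_{Y|X,A}(y_i|x_i,a_i)$. For $\Gamma\in\mathbb R$, a rate pair $(R_X,R_Y)$ is achievable at cost $\Gamma$ if there is a sequence of $(2^{nR_X},2^{nR_Y},n)$ codes, $n=1,2,\dots$, each satisfying $E\big[\frac1n\sum_{i=1}^n\Lambda(A_i)\big]\le\Gamma$,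 with $\Pr\big((X^n,Y^n)\ne g(T_1(X^n),T_2(Y^n))\big)\to0$ as $n\to\infty$. The optimal rate region $\mathcal R_B(\Gamma)$ is the closed convex hull of the set of rate pairs achievable at cost $\Gamma$, and $\mathcal R_B$ is the set of triplets $(R_X,R_Y,\Gamma)$ with $(R_X,R_Y)\in\mathcal R_B(\Gamma)$. **Theorem.** $\mathcal R_B$ is the closure of the set $\mathcal S$ of triplets $(R_X,R_Y,\Gamma)$ with $R_X,R_Y\ge0$ such that $$R_X\ge H(X|Y,A)+I(X;A)-I(Y;A),\qquad R_Y\ge H(Y|X,A),\qquad R_X+R_Y\ge H(X,Y|A)+I(X;A)$$ for some joint pmf of the form $P_{X,A,Y}=P_XP_{A|X}P_{Y|X,A}$ (with the given $P_X$ and $P_{Y|X,A}$, and $P_{A|X}$ arbitrary) under which $E[\Lambda(A)]\le\Gamma$; entropies and mutual informations are in bits. Moreover, for every $\Gamma$, $\mathcal R_B(\Gamma)$ is the closure of the set of pairs $(R_X,R_Y)$ with $(R_X,R_Y,\Gamma)\in\mathcal S$. -/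

import Mathlib

open Filter Topology
open scoped BigOperators

/-! ### Information measures on a finite probability space (logarithms to base 2)

A pmf on a finite set is a function in the standard simplex. Random variables on the finite
probability space `(Ω, p)` are functions on `Ω`. -/

noncomputable section InformationMeasures

variable {Ω U V : Type*} [Fintype Ω] [Fintype U] [Fintype V] [DecidableEq U] [DecidableEq V]

/-- The pmf of the random variable `f` on the finite probability space `(Ω, p)`. -/
def law (p : Ω → ℝ) (f : Ω → U) (u : U) : ℝ :=
  ∑ ω, if f ω = u then p ω else 0

/-- Entropy `H(f) = -∑ P(u) log₂ P(u)`, in bits. -/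
def entropy (p : Ω → ℝ) (f : Ω → U) : ℝ :=
  -∑ u, law p f u * Real.logb 2 (law p f u)

/-- Conditional entropy `H(f | g) = -∑ P(u, v) log₂ (P(u, v) / P(v))`. -/
def condEntropy (p : Ω → ℝ) (f : Ω → U) (g : Ω → V) : ℝ :=
  -∑ u, ∑ v, law p (fun ω => (f ω, g ω)) (u, v) *
    Real.logb 2 (law p (fun ω => (f ω, g ω)) (u, v) / law p g v)

/-- Mutual information `I(f; g) = ∑ P(u, v) log₂ (P(u, v) / (P(u) P(v)))`. -/
def mutualInfo (p : Ω → ℝ) (f : Ω → U) (g : Ω → V) : ℝ :=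
  ∑ u, ∑ v, law p (fun ω => (f ω, g ω)) (u, v) *
    Real.logb 2 (law p (fun ω => (f ω, g ω)) (u, v) / (law p f u * law p g v))

end InformationMeasures

/-! ### Correlated sources with actions taken at encoder 1 -/

/-- A `(2^{n R_X}, 2^{n R_Y}, n)` code with actions at encoder 1. The message sets are
`{1, …, ⌊2^{nR}⌋}`. -/
structure ActionCode (X A Y : Type*) (RX RY : ℝ) (n : ℕ) where
  /-- Encoder 1. -/
  enc₁ : (Fin n → X) → Fin ⌊(2 : ℝ) ^ ((n : ℝ) * RX)⌋₊
  /-- Encoder 2. -/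
  enc₂ : (Fin n → Y) → Fin ⌊(2 : ℝ) ^ ((n : ℝ) * RY)⌋₊
  /-- The strategy: the action sequence chosen by encoder 1 on observing the source `X^n`. -/
  strategy : (Fin n → X) → (Fin n → A)
  /-- The decoder. -/
  dec : Fin ⌊(2 : ℝ) ^ ((n : ℝ) * RX)⌋₊ × Fin ⌊(2 : ℝ) ^ ((n : ℝ) * RY)⌋₊ →
    (Fin n → X) × (Fin n → Y)

noncomputable section Region

variable {X A Y : Type*} [Fintype X] [DecidableEq X] [Fintype A] [DecidableEq A]
  [Fintype Y] [DecidableEq Y]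

/-- The probability of `X^n = x`, the source being i.i.d. with pmf `PX`. -/
def sourceProb (PX : X → ℝ) {n : ℕ} (x : Fin n → X) : ℝ :=
  ∏ i, PX (x i)

/-- The probability of `Y^n = y` given `X^n = x` and `A^n = a`, where `W x a y = P_{Y|X,A}(y|x,a)`
is a memoryless channel. -/
def channelProb (W : X → A → Y → ℝ) {n : ℕ} (x : Fin n → X) (a : Fin n → A) (y : Fin n → Y) : ℝ :=
  ∏ i, W (x i) (a i) (y i)

namespace ActionCode

variable {RX RY : ℝ} {n : ℕ}

/-- `Pr ((X^n, Y^n) ≠ g(T₁(X^n), T₂(Y^n)))`. -/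
def errorProb (PX : X → ℝ) (W : X → A → Y → ℝ) (c : ActionCode X A Y RX RY n) : ℝ :=
  ∑ x : Fin n → X, ∑ y : Fin n → Y,
    if (x, y) ≠ c.dec (c.enc₁ x, c.enc₂ y) then
      sourceProb PX x * channelProb W x (c.strategy x) y
    else 0

/-- `E[(1/n) ∑ Λ(A_i)]`. -/
def expectedCost (PX : X → ℝ) (Λ : A → ℝ) (c : ActionCode X A Y RX RY n) : ℝ :=
  ∑ x : Fin n → X, sourceProb PX x * ((1 / (n : ℝ)) * ∑ i, Λ (c.strategy x i))

end ActionCode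

/-- The rate pair `r = (R_X, R_Y)` is achievable under the cost constraint `Γ`. -/
def Achievable (PX : X → ℝ) (W : X → A → Y → ℝ) (Λ : A → ℝ) (Γ : ℝ) (r : ℝ × ℝ) : Prop :=
  ∃ c : (n : ℕ) → ActionCode X A Y r.1 r.2 n,
    (∀ n, 1 ≤ n → (c n).expectedCost PX Λ ≤ Γ) ∧
    Tendsto (fun n => (c n).errorProb PX W) atTop (𝓝 0)

/-- The optimal rate region at cost `Γ`: the convex closure of the achievable rate pairs. -/
def optimalRateRegion (PX : X → ℝ) (W : X → A → Y → ℝ) (Λ : A → ℝ) (Γ : ℝ) : Set (ℝ × ℝ) :=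
  closure (convexHull ℝ {r | Achievable PX W Λ Γ r})

/-- The joint pmf `P_X P_{A|X} P_{Y|X,A}` of `(X, A, Y)`, with `Q x a = P_{A|X}(a|x)`. -/
def jointLaw (PX : X → ℝ) (Q : X → A → ℝ) (W : X → A → Y → ℝ) : X × A × Y → ℝ :=
  fun ω => PX ω.1 * Q ω.1 ω.2.1 * W ω.1 ω.2.1 ω.2.2

/-- The set of triplets `(R_X, R_Y, Γ)`, with nonnegative rates, that satisfy the single-letter
bounds for some joint pmf `P_X P_{A|X} P_{Y|X,A}` under which `E[Λ(A)] ≤ Γ`. -/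
def singleLetterTriplets (PX : X → ℝ) (W : X → A → Y → ℝ) (Λ : A → ℝ) : Set (ℝ × ℝ × ℝ) :=
  {t | ∃ Q : X → A → ℝ, (∀ x, Q x ∈ stdSimplex ℝ A) ∧
    let RX := t.1
    let RY := t.2.1
    let Γ := t.2.2
    let p := jointLaw PX Q W
    let vX : X × A × Y → X := fun ω => ω.1
    let vA : X × A × Y → A := fun ω => ω.2.1
    let vY : X × A × Y → Y := fun ω => ω.2.2
    ∑ ω, p ω * Λ (vA ω) ≤ Γ ∧
    0 ≤ RX ∧ 0 ≤ RY ∧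
    condEntropy p vX (fun ω => (vY ω, vA ω)) + mutualInfo p vX vA - mutualInfo p vY vA ≤ RX ∧
    condEntropy p vY (fun ω => (vX ω, vA ω)) ≤ RY ∧
    condEntropy p (fun ω => (vX ω, vY ω)) vA + mutualInfo p vX vA ≤ RX + RY}

end Region

/-! Write `Q` for P_{A|X} and `W` for P_{Y|X,A}. The three bounds collapse to H(X) + H(Y|X,A) -
H(Y), H(Y|X,A) and H(X) + H(Y|X,A) (`bound_X_eq`, `bound_Y_eq`, `bound_sum_eq`). They are the means
of log(P_Y / (P_X W)), log(1 / W) and log(1 / (P_X W)), and both directions work with these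
log-ratios directly.

Achievability. For each source block, draw an action block from the memoryless extension of `Q` and
a uniform bin; bin the Y-blocks uniformly as well. The decoder seeks a pair in the two announced
bins that passes three threshold tests, one for each log-ratio. The true pair passes up to an
exponentially small probability (`exists_geometric_tail_bound`). A change of measure shows that
wrong x, wrong y and wrong pairs cost at most K₁/M₁, K₂/M₂ and K₃/(M₁M₂) on average
(`exists_one_shot_code`). A wrong x carries its own independent actions, and this is the source of
the gain H(Y) in the first bound. The cost constraint must hold exactly for one fixed code, so `Q`
is first mixed slightly with the cheapest action, and the slack gained allows one code to be good
for cost and error together.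

Converse. The averaged conditional law of the actions of a code is an admissible `Q`, because the
source is i.i.d., and additive block functionals have the same mean under it (`sum_code_law`).
Gibbs' inequality is applied to the block law against a reference measure: a product density (P_Y,
P_X or 1) times a weight 1/(2M) on correctly decoded pairs and 1/(2K) elsewhere. Correctly decoded
pairs with one block fixed number at most M, so this measure has mass at most one. The result is
Fano's inequality already in single-letter form (`block_converse_bound`).

The single-letter set is closed, since `Q` ranges over a compact set, and its slices are convex,
since -H(Y) is convex in `Q` and all else is affine. Hence the limit in the converse, the convex
hull and the closures stay inside it. -/

set_option linter.unusedSectionVars false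

/-! ### Sums against product weights -/

section ProductWeights

variable {ι β : Type*} [Fintype ι] [DecidableEq ι] [Fintype β]

theorem sum_pi_prod (q : ι → β → ℝ) : ∑ h : ι → β, ∏ j, q j (h j) = ∏ j, ∑ b, q j b := by
  rw [Finset.prod_univ_sum, Fintype.piFinset_univ]

theorem sum_pi_prod_eq_one {q : ι → β → ℝ} (hq : ∀ j, ∑ b, q j b = 1) :
    ∑ h : ι → β, ∏ j, q j (h j) = 1 := by
  rw [sum_pi_prod]; simp [hq]

/-- Attaching `F` to the `i`-th factor keeps the product form, and every other factor sums to one.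
-/
theorem sum_pi_prod_mul_eval {q : ι → β → ℝ} (hq : ∀ j, ∑ b, q j b = 1) (i : ι) (F : β → ℝ) :
    ∑ h : ι → β, (∏ j, q j (h j)) * F (h i) = ∑ b, q i b * F b := by
  have h1 : ∀ h : ι → β, (∏ j, q j (h j)) * F (h i)
      = ∏ j, (q j (h j) * if j = i then F (h j) else 1) := by
    intro h
    rw [Finset.prod_mul_distrib]
    simp
  simp_rw [h1]
  rw [sum_pi_prod (fun j b => q j b * if j = i then F b else 1),
    Finset.prod_eq_single i]
  · simp
  · intro j _ hj
    simp [hj, hq]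
  · simp

/-- Two distinct coordinates are independent. This is clear for products `f (h i) * g (h k)`, and
these span all functions of two coordinates. -/
theorem sum_pi_prod_mul_eval₂ {q : ι → β → ℝ} (hq : ∀ j, ∑ b, q j b = 1) {i k : ι} (hik : i ≠ k)
    (F : β → β → ℝ) :
    ∑ h : ι → β, (∏ j, q j (h j)) * F (h i) (h k) = ∑ b, ∑ b', q i b * q k b' * F b b' := by
  classical
  have h0 : ∀ f g : β → ℝ, ∑ h : ι → β, (∏ j, q j (h j)) * (f (h i) * g (h k))
      = (∑ b, q i b * f b) * ∑ b, q k b * g b := by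
    intro f g
    have h1 : ∀ h : ι → β, (∏ j, q j (h j)) * (f (h i) * g (h k))
        = ∏ j, (q j (h j) * ((if j = i then f (h j) else 1) * if j = k then g (h j) else 1)) := by
      intro h
      rw [Finset.prod_mul_distrib, Finset.prod_mul_distrib]
      simp
    simp_rw [h1]
    rw [sum_pi_prod (fun j b => q j b * ((if j = i then f b else 1) * if j = k then g b else 1)),
      Finset.prod_eq_mul i k hik]
    · simp [hik, hik.symm]
    · intro j _ hj
      simp [hj.1, hj.2, hq]
    · simp
    · simp
  have h2 : ∀ b b', F b b' = ∑ c, ∑ c', F c c' *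
      ((if b = c then 1 else 0) * (if b' = c' then 1 else 0)) := by
    intro b b'
    simp
  calc ∑ h : ι → β, (∏ j, q j (h j)) * F (h i) (h k)
      = ∑ h : ι → β, ∑ c, ∑ c', F c c' * ((∏ j, q j (h j)) *
        ((if h i = c then 1 else 0) * (if h k = c' then 1 else 0))) := by
        refine Finset.sum_congr rfl fun h _ => ?_
        conv_lhs => rw [h2 (h i) (h k)]
        simp_rw [Finset.mul_sum]
        refine Finset.sum_congr rfl fun c _ => Finset.sum_congr rfl fun c' _ => ?_
        ring
    _ = ∑ c, ∑ c', F c c' * ∑ h : ι → β, ((∏ j, q j (h j)) *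
        ((if h i = c then 1 else 0) * (if h k = c' then 1 else 0))) := by
        rw [Finset.sum_comm]
        refine Finset.sum_congr rfl fun c _ => ?_
        rw [Finset.sum_comm]
        simp_rw [Finset.mul_sum]
    _ = _ := by
        refine Finset.sum_congr rfl fun c _ => Finset.sum_congr rfl fun c' _ => ?_
        rw [h0 (fun b => if b = c then 1 else 0) (fun b => if b = c' then 1 else 0)]
        simp
        ring

end ProductWeights

/-! ### Gibbs' inequality and a Chernoff bound -/

/-- Comes from log t ≤ t - 1 at t = q/p. Only the total mass of `q` matters, so a subnormalised
reference is allowed; the converse uses one. -/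
theorem gibbs_inequality {Ω : Type*} [Fintype Ω] {p q : Ω → ℝ} (hp : ∀ ω, 0 ≤ p ω)
    (hq : ∀ ω, 0 ≤ q ω) (hpq : ∀ ω, 0 < p ω → 0 < q ω) (hsum : ∑ ω, q ω ≤ ∑ ω, p ω) :
    ∑ ω, p ω * (Real.logb 2 (q ω) - Real.logb 2 (p ω)) ≤ 0 := by
  have hl2 : 0 < Real.log 2 := Real.log_pos (by norm_num)
  have h1 : ∀ ω, p ω * (Real.log (q ω) - Real.log (p ω)) ≤ q ω - p ω := by
    intro ω
    rcases (hp ω).eq_or_lt with h | h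
    · rw [← h]; simpa using hq ω
    · have hq' := hpq ω h
      rw [← Real.log_div hq'.ne' h.ne']
      have := Real.log_le_sub_one_of_pos (div_pos hq' h)
      calc p ω * Real.log (q ω / p ω) ≤ p ω * (q ω / p ω - 1) := by gcongr
        _ = q ω - p ω := by field_simp
  have h2 : ∑ ω, p ω * (Real.log (q ω) - Real.log (p ω)) ≤ 0 := by
    calc _ ≤ ∑ ω, (q ω - p ω) := Finset.sum_le_sum fun ω _ => h1 ω
      _ ≤ 0 := by rw [Finset.sum_sub_distrib]; linarith
  have h3 : ∑ ω, p ω * (Real.logb 2 (q ω) - Real.logb 2 (p ω))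
      = (∑ ω, p ω * (Real.log (q ω) - Real.log (p ω))) / Real.log 2 := by
    rw [Finset.sum_div]
    refine Finset.sum_congr rfl fun ω _ => ?_
    simp only [Real.logb]; ring
  rw [h3]
  exact div_nonpos_of_nonpos_of_nonneg h2 hl2.le

/-- The moment generating function equals 1 at 0 and its derivative there is the negative mean, so
it drops below 1 just to the right. -/
theorem exists_sum_mul_exp_lt_one {Ω : Type*} [Fintype Ω] {p f : Ω → ℝ} (hp : p ∈ stdSimplex ℝ Ω)
    (hf : ∑ ω, p ω * f ω < 0) : ∃ s : ℝ, 0 < s ∧ ∑ ω, p ω * Real.exp (s * f ω) < 1 := by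
  have hd : HasDerivAt (fun s : ℝ => ∑ ω, p ω * Real.exp (s * f ω)) (∑ ω, p ω * f ω) 0 := by
    refine HasDerivAt.fun_sum fun ω _ => ?_
    have := (((hasDerivAt_id (0 : ℝ)).mul_const (f ω)).exp).const_mul (p ω)
    simpa using this
  have h1 := hd.hasDerivWithinAt (s := Set.Ioi 0)
  have h2 := hasDerivWithinAt_iff_tendsto_slope.1 h1
  have h3 : ∀ᶠ s in 𝓝[Set.Ioi 0 \ {0}] (0 : ℝ),
      slope (fun s : ℝ => ∑ ω, p ω * Real.exp (s * f ω)) 0 s < 0 := h2.eventually_lt_const hf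
  have h4 : Set.Ioi (0 : ℝ) \ {0} = Set.Ioi 0 := by ext s; simp
  rw [h4] at h3
  obtain ⟨s, hs, hs0⟩ := (h3.and self_mem_nhdsWithin).exists
  refine ⟨s, hs0, ?_⟩
  have hs0' : 0 < s := hs0
  rw [slope_def_field] at hs
  simp only [zero_mul, Real.exp_zero, mul_one, hp.2, sub_zero] at hs
  by_contra hcon
  exact absurd hs (not_lt.mpr (div_nonneg (by linarith) hs0'.le))

/-- If the mean of `log (d / g)` is less than `r`, then the probability that
`∏ d > 2^{n r} ∏ g` decays exponentially for i.i.d. samples. -/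
theorem exists_geometric_tail_bound {Ω : Type*} [Fintype Ω] {p g d : Ω → ℝ}
    (hp : p ∈ stdSimplex ℝ Ω) (hg : ∀ ω, 0 < p ω → 0 < g ω) (hd : ∀ ω, 0 < p ω → 0 < d ω) {r : ℝ}
    (hr : ∑ ω, p ω * (Real.logb 2 (d ω) - Real.logb 2 (g ω)) < r) :
    ∃ ρ : ℝ, 0 ≤ ρ ∧ ρ < 1 ∧ ∀ n : ℕ, (∑ ω : Fin n → Ω, (∏ i, p (ω i)) *
      if (2 : ℝ) ^ ((n : ℝ) * r) * ∏ i, g (ω i) < ∏ i, d (ω i) then 1 else 0) ≤ ρ ^ n := by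
  have hl2 : 0 < Real.log 2 := Real.log_pos (by norm_num)
  set f : Ω → ℝ := fun ω => Real.log (d ω) - Real.log (g ω) - r * Real.log 2 with hfdef
  have hf : ∑ ω, p ω * f ω < 0 := by
    have h3 : ∑ ω, p ω * f ω = ((∑ ω, p ω * (Real.logb 2 (d ω) - Real.logb 2 (g ω))) - r)
        * Real.log 2 := by
      rw [sub_mul, Finset.sum_mul]
      have : r * Real.log 2 = ∑ ω, p ω * (r * Real.log 2) := by
        rw [← Finset.sum_mul, hp.2, one_mul]
      rw [this, ← Finset.sum_sub_distrib]
      refine Finset.sum_congr rfl fun ω _ => ?_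
      simp only [hfdef, Real.logb]; field_simp
    rw [h3]
    exact mul_neg_of_neg_of_pos (by linarith) hl2
  obtain ⟨s, hs, hlt⟩ := exists_sum_mul_exp_lt_one hp hf
  -- Chernoff: ρ is the moment generating function at `s`, and the indicator of the event is at most
  -- exp(s ∑ f).
  refine ⟨_, Finset.sum_nonneg fun ω _ => mul_nonneg (hp.1 ω) (Real.exp_nonneg _), hlt, fun n => ?_⟩
  have h1 : (∑ ω, p ω * Real.exp (s * f ω)) ^ n
      = ∑ ω : Fin n → Ω, ∏ i, (p (ω i) * Real.exp (s * f (ω i))) := by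
    rw [sum_pi_prod (fun (_ : Fin n) ω => p ω * Real.exp (s * f ω))]
    simp
  rw [h1]
  refine Finset.sum_le_sum fun ω _ => ?_
  rw [Finset.prod_mul_distrib]
  by_cases hpos : ∀ i, 0 < p (ω i)
  · refine mul_le_mul_of_nonneg_left ?_ (Finset.prod_nonneg fun i _ => (hpos i).le)
    split_ifs with h
    · rw [← Real.exp_sum, ← Finset.mul_sum]
      refine Real.one_le_exp (mul_nonneg hs.le ?_)
      have hgp : 0 < ∏ i, g (ω i) := Finset.prod_pos fun i _ => hg _ (hpos i)
      have h2 := Real.log_lt_log (mul_pos (Real.rpow_pos_of_pos two_pos _) hgp) h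
      rw [Real.log_mul (Real.rpow_pos_of_pos two_pos _).ne' hgp.ne', Real.log_rpow two_pos,
        Real.log_prod (fun i _ => (hg _ (hpos i)).ne'),
        Real.log_prod (fun i _ => (hd _ (hpos i)).ne')] at h2
      simp only [hfdef, Finset.sum_sub_distrib, Finset.sum_const, Finset.card_univ,
        Fintype.card_fin, nsmul_eq_mul]
      linarith
    · exact Finset.prod_nonneg fun i _ => Real.exp_nonneg _
  · push Not at hpos
    obtain ⟨i, hi⟩ := hpos
    have : p (ω i) = 0 := le_antisymm hi (hp.1 _)
    rw [Finset.prod_eq_zero (Finset.mem_univ i) this]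
    simp

/-- If the mean of `Z ≥ 0` is at most `(1 - δ) t` and that of `E` at most `δ e`, then `Z ≤ t` and
`E ≤ e` hold simultaneously at some point. -/
theorem exists_le_and_le_of_mean_le {C : Type*} [Fintype C] {w Z E : C → ℝ}
    (hw : w ∈ stdSimplex ℝ C) (hZ : ∀ c, 0 ≤ Z c) (hE : ∀ c, 0 ≤ E c) {δ t e : ℝ} (hδ : δ ≤ 1)
    (ht : 0 ≤ t) (he : 0 < e) (hZt : ∑ c, w c * Z c ≤ (1 - δ) * t)
    (hEe : ∑ c, w c * E c ≤ δ * e) : ∃ c, Z c ≤ t ∧ E c ≤ e := by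
  by_contra! hcon
  have hex : ∃ c, 0 < w c := by
    by_contra! h
    have : ∑ c, w c ≤ 0 := Finset.sum_nonpos fun c _ => h c
    rw [hw.2] at this; linarith
  obtain ⟨c₀, hc₀⟩ := hex
  -- For t = 0 division by `t` is unavailable. Then `Z` vanishes wherever `w` does not, so `E`
  -- exceeds `e` there and its mean exceeds `e`.
  rcases ht.eq_or_lt with h0 | h0
  · subst h0
    have hz : ∀ c, w c * Z c = 0 := by
      have h1 : ∑ c, w c * Z c = 0 := le_antisymm (by simpa using hZt)
        (Finset.sum_nonneg fun c _ => mul_nonneg (hw.1 c) (hZ c))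
      intro c
      exact (Finset.sum_eq_zero_iff_of_nonneg
        (fun c _ => mul_nonneg (hw.1 c) (hZ c))).1 h1 c (Finset.mem_univ c)
    have h2 : ∀ c, w c * e ≤ w c * E c := by
      intro c
      rcases (hw.1 c).eq_or_lt with h | h
      · rw [← h]; simp
      · have hzc : Z c = 0 := by
          rcases mul_eq_zero.1 (hz c) with h' | h'
          · exact absurd h' h.ne'
          · exact h'
        exact mul_le_mul_of_nonneg_left (hcon c hzc.le).le h.le
    have hzc₀ : Z c₀ = 0 := by
      rcases mul_eq_zero.1 (hz c₀) with h' | h'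
      · exact absurd h' hc₀.ne'
      · exact h'
    have h3 : ∑ c, w c * e < ∑ c, w c * E c :=
      Finset.sum_lt_sum (fun c _ => h2 c)
        ⟨c₀, Finset.mem_univ _, mul_lt_mul_of_pos_left (hcon c₀ hzc₀.le) hc₀⟩
    rw [← Finset.sum_mul, hw.2, one_mul] at h3
    nlinarith
  -- If no point works, Z/t + E/e exceeds 1 everywhere, although its mean is at most (1 - δ) + δ.
  · have h1 : ∀ c, 1 < Z c / t + E c / e := by
      intro c
      rcases le_or_gt (Z c) t with h | h
      · have := (one_lt_div he).2 (hcon c h)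
        have := div_nonneg (hZ c) h0.le
        linarith
      · have := (one_lt_div h0).2 h
        have := div_nonneg (hE c) he.le
        linarith
    have h2 : ∑ c, w c * 1 < ∑ c, w c * (Z c / t + E c / e) :=
      Finset.sum_lt_sum (fun c _ => mul_le_mul_of_nonneg_left (h1 c).le (hw.1 c))
        ⟨c₀, Finset.mem_univ _, mul_lt_mul_of_pos_left (h1 c₀) hc₀⟩
    have h3 : ∑ c, w c * (Z c / t + E c / e)
        = (∑ c, w c * Z c) / t + (∑ c, w c * E c) / e := by
      rw [Finset.sum_div, Finset.sum_div, ← Finset.sum_add_distrib]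
      exact Finset.sum_congr rfl fun c _ => by ring
    rw [h3, ← Finset.sum_mul, hw.2] at h2
    have h4 : (∑ c, w c * Z c) / t ≤ 1 - δ := (div_le_iff₀ h0).2 hZt
    have h5 : (∑ c, w c * E c) / e ≤ δ := (div_le_iff₀ he).2 hEe
    linarith

/-! ### Random strategies and random binning -/

section RandomBinning

variable {𝒳 𝒜 𝒴 : Type*} [Fintype 𝒳] [DecidableEq 𝒳] [Fintype 𝒜] [DecidableEq 𝒜]
  [Fintype 𝒴] [DecidableEq 𝒴]

/-- The weight of a random first encoder: for every `x`, an action drawn from `Q x` and a uniform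
bin, all independent. -/
noncomputable def actionBinWeight (Q : 𝒳 → 𝒜 → ℝ) {M : ℕ} (c : 𝒳 → 𝒜 × Fin M) : ℝ :=
  ∏ x, Q x (c x).1 * (1 / (M : ℝ))

/-- The weight of a uniformly random binning. -/
noncomputable def binWeight {M : ℕ} (_ : 𝒴 → Fin M) : ℝ :=
  ∏ _y : 𝒴, 1 / (M : ℝ)

theorem sum_const_inv {M : ℕ} (hM : 0 < M) : ∑ _m : Fin M, 1 / (M : ℝ) = 1 := by
  have : (M : ℝ) ≠ 0 := by exact_mod_cast hM.ne'
  simp [this]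

theorem sum_action_bin {Q : 𝒜 → ℝ} {M : ℕ} (hM : 0 < M) (f : 𝒜 → ℝ) :
    ∑ b : 𝒜 × Fin M, Q b.1 * (1 / (M : ℝ)) * f b.1 = ∑ a, Q a * f a := by
  rw [Fintype.sum_prod_type]
  refine Finset.sum_congr rfl fun a _ => ?_
  have := sum_const_inv hM
  calc ∑ _m : Fin M, Q a * (1 / (M : ℝ)) * f a = (∑ _m : Fin M, 1 / (M : ℝ)) * (Q a * f a) := by
        rw [Finset.sum_mul]; exact Finset.sum_congr rfl fun _ _ => by ring
    _ = _ := by rw [this, one_mul]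

theorem sum_action_bin_eq_one {Q : 𝒳 → 𝒜 → ℝ} (hQ : ∀ x, Q x ∈ stdSimplex ℝ 𝒜) {M : ℕ}
    (hM : 0 < M) (x : 𝒳) : ∑ b : 𝒜 × Fin M, Q x b.1 * (1 / (M : ℝ)) = 1 := by
  have := sum_action_bin (Q := Q x) hM (fun _ => 1)
  simpa only [mul_one, (hQ x).2] using this

theorem actionBinWeight_mem {Q : 𝒳 → 𝒜 → ℝ} (hQ : ∀ x, Q x ∈ stdSimplex ℝ 𝒜) {M : ℕ}
    (hM : 0 < M) :
    (actionBinWeight Q : (𝒳 → 𝒜 × Fin M) → ℝ) ∈ stdSimplex ℝ (𝒳 → 𝒜 × Fin M) :=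
  ⟨fun _ => Finset.prod_nonneg fun _ _ => mul_nonneg ((hQ _).1 _) (by positivity),
    sum_pi_prod_eq_one (q := fun x (b : 𝒜 × Fin M) => Q x b.1 * (1 / (M : ℝ)))
      (sum_action_bin_eq_one hQ hM)⟩

theorem binWeight_mem {M : ℕ} (hM : 0 < M) :
    (binWeight : (𝒴 → Fin M) → ℝ) ∈ stdSimplex ℝ (𝒴 → Fin M) :=
  ⟨fun _ => Finset.prod_nonneg fun _ _ => by positivity,
    sum_pi_prod_eq_one (q := fun (_ : 𝒴) (_ : Fin M) => 1 / (M : ℝ)) fun _ => sum_const_inv hM⟩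

theorem mean_actionBin_eval {Q : 𝒳 → 𝒜 → ℝ} (hQ : ∀ x, Q x ∈ stdSimplex ℝ 𝒜) {M : ℕ}
    (hM : 0 < M) (x : 𝒳) (f : 𝒜 → ℝ) :
    ∑ c : 𝒳 → 𝒜 × Fin M, actionBinWeight Q c * f (c x).1 = ∑ a, Q x a * f a := by
  exact (sum_pi_prod_mul_eval (q := fun x (b : 𝒜 × Fin M) => Q x b.1 * (1 / (M : ℝ)))
    (sum_action_bin_eq_one hQ hM) x (fun b => f b.1)).trans (sum_action_bin hM f)

/-- Distinct sources draw their actions and bins independently, and the bins agree with probability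
1/M whatever the actions are. -/
theorem mean_actionBin_collision {Q : 𝒳 → 𝒜 → ℝ} (hQ : ∀ x, Q x ∈ stdSimplex ℝ 𝒜) {M : ℕ}
    (hM : 0 < M) {x x' : 𝒳} (hx : x ≠ x') (f g : 𝒜 → ℝ) :
    ∑ c : 𝒳 → 𝒜 × Fin M, actionBinWeight Q c *
      (f (c x).1 * ((if (c x').2 = (c x).2 then 1 else 0) * g (c x').1))
      = (∑ a, Q x a * f a) * ((∑ a, Q x' a * g a) * (1 / (M : ℝ))) := by
  have h := sum_pi_prod_mul_eval₂ (q := fun x (b : 𝒜 × Fin M) => Q x b.1 * (1 / (M : ℝ)))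
    (sum_action_bin_eq_one hQ hM) hx
    (fun b b' => f b.1 * ((if b'.2 = b.2 then 1 else 0) * g b'.1))
  refine h.trans ?_
  have h1 : ∀ b : 𝒜 × Fin M, ∑ b' : 𝒜 × Fin M, Q x b.1 * (1 / (M : ℝ)) *
      (Q x' b'.1 * (1 / (M : ℝ))) * (f b.1 * ((if b'.2 = b.2 then 1 else 0) * g b'.1))
      = Q x b.1 * (1 / (M : ℝ)) * (f b.1 * ((∑ a, Q x' a * g a) * (1 / (M : ℝ)))) := by
    intro b
    rw [Fintype.sum_prod_type]
    simp only [mul_ite, mul_zero, ite_mul, one_mul, zero_mul, Finset.sum_ite_eq',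
      Finset.mem_univ, if_true]
    rw [Finset.sum_mul, Finset.mul_sum, Finset.mul_sum]
    refine Finset.sum_congr rfl fun a _ => ?_
    ring
  have h2 := Finset.sum_congr (rfl : (Finset.univ : Finset (𝒜 × Fin M)) = _) fun b _ => h1 b
  refine h2.trans ?_
  rw [sum_action_bin hM (fun a => f a * ((∑ a, Q x' a * g a) * (1 / (M : ℝ))))]
  simp_rw [← mul_assoc, ← Finset.sum_mul]

theorem mean_bin_collision {M : ℕ} (hM : 0 < M) {y y' : 𝒴} (hy : y ≠ y') :
    ∑ c : 𝒴 → Fin M, binWeight c * (if c y' = c y then 1 else 0) = 1 / (M : ℝ) := by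
  have h := sum_pi_prod_mul_eval₂ (q := fun (_ : 𝒴) (_ : Fin M) => 1 / (M : ℝ))
    (fun _ => sum_const_inv hM) hy (fun b b' => if b' = b then 1 else 0)
  refine h.trans ?_
  simp only [mul_ite, mul_one, mul_zero, Finset.sum_ite_eq', Finset.mem_univ, if_true]
  rw [← Finset.mul_sum, sum_const_inv hM, mul_one]

/-- The decoder outputs any pair in the two bins that satisfies `S`. When the true pair satisfies
`S`, a wrong output is itself the required rival. -/
theorem exists_bin_decoder [Nonempty 𝒳] [Nonempty 𝒴] {M₁ M₂ : ℕ} (b₁ : 𝒳 → Fin M₁)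
    (b₂ : 𝒴 → Fin M₂) (S : 𝒳 → 𝒴 → Prop) : ∃ dec : Fin M₁ × Fin M₂ → 𝒳 × 𝒴, ∀ x y, S x y →
      (x, y) ≠ dec (b₁ x, b₂ y) → ∃ x' y', (x', y') ≠ (x, y) ∧ b₁ x' = b₁ x ∧ b₂ y' = b₂ y ∧
        S x' y' := by
  classical
  refine ⟨fun m => if h : ∃ z : 𝒳 × 𝒴, b₁ z.1 = m.1 ∧ b₂ z.2 = m.2 ∧ S z.1 z.2 then h.choose
    else Classical.arbitrary _, fun x y hS hne => ?_⟩
  have hex : ∃ z : 𝒳 × 𝒴, b₁ z.1 = b₁ x ∧ b₂ z.2 = b₂ y ∧ S z.1 z.2 := ⟨(x, y), rfl, rfl, hS⟩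
  simp only [hex, dif_pos] at hne
  obtain ⟨h1, h2, h3⟩ := hex.choose_spec
  exact ⟨_, _, hne.symm, h1, h2, h3⟩

/-- The union bound over the confusable pairs. -/
noncomputable def confusionBound (T : 𝒳 → 𝒜 → 𝒴 → ℝ) {M₁ M₂ : ℕ} (c₁ : 𝒳 → 𝒜 × Fin M₁)
    (c₂ : 𝒴 → Fin M₂) (x : 𝒳) (y : 𝒴) : ℝ :=
  (1 - T x (c₁ x).1 y) +
  ∑ x', (if x = x' then 0 else (if (c₁ x').2 = (c₁ x).2 then 1 else 0) * T x' (c₁ x').1 y) +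
  ∑ y', (if y = y' then 0 else (if c₂ y' = c₂ y then 1 else 0) * T x (c₁ x).1 y') +
  ∑ x', ∑ y', (if x = x' then 0 else if y = y' then 0 else (if c₂ y' = c₂ y then 1 else 0) *
    ((if (c₁ x').2 = (c₁ x).2 then 1 else 0) * T x' (c₁ x').1 y'))

/-- An error means that the true pair fails the test or that a rival passes it; the three sums sort
rivals by the coordinates in which they differ. -/
theorem exists_decoder_error_le [Nonempty 𝒳] [Nonempty 𝒴] {T : 𝒳 → 𝒜 → 𝒴 → ℝ}
    (hT : ∀ x a y, T x a y = 0 ∨ T x a y = 1) {M₁ M₂ : ℕ} (c₁ : 𝒳 → 𝒜 × Fin M₁)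
    (c₂ : 𝒴 → Fin M₂) : ∃ dec : Fin M₁ × Fin M₂ → 𝒳 × 𝒴, ∀ x y,
      (if (x, y) ≠ dec ((c₁ x).2, c₂ y) then (1 : ℝ) else 0) ≤ confusionBound T c₁ c₂ x y := by
  obtain ⟨dec, hdec⟩ := exists_bin_decoder (fun x => (c₁ x).2) c₂
    (fun x y => T x (c₁ x).1 y = 1)
  have hT0 : ∀ x a y, 0 ≤ T x a y := fun x a y => by rcases hT x a y with h | h <;> simp [h]
  have hT1 : ∀ x a y, 0 ≤ 1 - T x a y := fun x a y => by rcases hT x a y with h | h <;> simp [h]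
  refine ⟨dec, fun x y => ?_⟩
  have n1 : ∀ x', 0 ≤ (if x = x' then 0 else
      (if (c₁ x').2 = (c₁ x).2 then (1 : ℝ) else 0) * T x' (c₁ x').1 y) := fun x' => by
    have := hT0 x' (c₁ x').1 y
    split_ifs <;> simp [this]
  have n2 : ∀ y', 0 ≤ (if y = y' then 0 else
      (if c₂ y' = c₂ y then (1 : ℝ) else 0) * T x (c₁ x).1 y') := fun y' => by
    have := hT0 x (c₁ x).1 y'
    split_ifs <;> simp [this]
  have n3 : ∀ x' y', 0 ≤ (if x = x' then 0 else if y = y' then 0 else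
      (if c₂ y' = c₂ y then (1 : ℝ) else 0) *
      ((if (c₁ x').2 = (c₁ x).2 then 1 else 0) * T x' (c₁ x').1 y')) := fun x' y' => by
    have := hT0 x' (c₁ x').1 y'
    split_ifs <;> simp [this]
  have s1 := Finset.sum_nonneg fun x' (_ : x' ∈ Finset.univ) => n1 x'
  have s2 := Finset.sum_nonneg fun y' (_ : y' ∈ Finset.univ) => n2 y'
  have s3 := Finset.sum_nonneg fun x' (_ : x' ∈ Finset.univ) =>
    Finset.sum_nonneg fun y' (_ : y' ∈ Finset.univ) => n3 x' y'
  have s0 := hT1 x (c₁ x).1 y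
  unfold confusionBound
  by_cases herr : (x, y) ≠ dec ((c₁ x).2, c₂ y)
  swap
  · rw [if_neg herr]; linarith
  rw [if_pos herr]
  rcases hT x (c₁ x).1 y with h | h
  · rw [h]; linarith
  obtain ⟨x', y', hne, hb1, hb2, hS⟩ := hdec x y h herr
  by_cases hx : x = x'
  · subst hx
    have hy : y ≠ y' := fun h => hne (by rw [h])
    have := Finset.single_le_sum (fun y' _ => n2 y') (Finset.mem_univ y')
    simp only [if_neg hy, if_pos hb2, hS, mul_one] at this
    linarith
  · by_cases hy : y = y'
    · subst hy
      have := Finset.single_le_sum (fun x' _ => n1 x') (Finset.mem_univ x')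
      simp only [if_neg hx, if_pos hb1, hS, mul_one] at this
      linarith
    · have h1 := Finset.single_le_sum (fun y' _ => n3 x' y') (Finset.mem_univ y')
      have h3 : (if x = x' then 0 else if y = y' then 0 else
          (if c₂ y' = c₂ y then (1 : ℝ) else 0) *
          ((if (c₁ x').2 = (c₁ x).2 then 1 else 0) * T x' (c₁ x').1 y')) = 1 := by
        rw [if_neg hx, if_neg hy, if_pos hb2, if_pos hb1, hS]; norm_num
      have h2 := Finset.single_le_sum (f := fun x' => ∑ y', (if x = x' then 0 else
        if y = y' then 0 else (if c₂ y' = c₂ y then (1 : ℝ) else 0) *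
        ((if (c₁ x').2 = (c₁ x).2 then 1 else 0) * T x' (c₁ x').1 y')))
        (fun x' _ => Finset.sum_nonneg fun y' _ => n3 x' y') (Finset.mem_univ x')
      rw [h3] at h1
      linarith

/-- The weight `f` will be the channel likelihood, which depends on the random action. It separates
from rivals `x' ≠ x`, whose actions are independent, but stays inside the sum when only `y` is
wrong, since then the action is shared. The inequality arises from restoring the excluded diagonal
terms. -/
theorem mean_confusionBound_le {T : 𝒳 → 𝒜 → 𝒴 → ℝ} (hT : ∀ x a y, 0 ≤ T x a y)
    {Q : 𝒳 → 𝒜 → ℝ} (hQ : ∀ x, Q x ∈ stdSimplex ℝ 𝒜) {M₁ M₂ : ℕ} (hM₁ : 0 < M₁) (hM₂ : 0 < M₂)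
    (x : 𝒳) (y : 𝒴) {f : 𝒜 → ℝ} (hf : ∀ a, 0 ≤ f a) :
    ∑ c₁ : 𝒳 → 𝒜 × Fin M₁, ∑ c₂ : 𝒴 → Fin M₂, actionBinWeight Q c₁ * binWeight c₂ *
      (f (c₁ x).1 * confusionBound T c₁ c₂ x y) ≤
    ∑ a, Q x a * (f a * (1 - T x a y)) +
    (∑ a, Q x a * f a) * ((∑ x', ∑ a', Q x' a' * T x' a' y) * (1 / (M₁ : ℝ))) +
    (∑ a, Q x a * (f a * ∑ y', T x a y')) * (1 / (M₂ : ℝ)) +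
    (∑ a, Q x a * f a) * ((∑ x', ∑ a', Q x' a' * ∑ y', T x' a' y') *
      (1 / (M₁ : ℝ)) * (1 / (M₂ : ℝ))) := by
  have hbw := (binWeight_mem (𝒴 := 𝒴) hM₂).2
  have hfQ : 0 ≤ ∑ a, Q x a * f a := Finset.sum_nonneg fun a _ => mul_nonneg ((hQ x).1 a) (hf a)
  have hM₁' : (0 : ℝ) ≤ 1 / (M₁ : ℝ) := by positivity
  have hM₂' : (0 : ℝ) ≤ 1 / (M₂ : ℝ) := by positivity
  -- The second binning is averaged first: only the comparisons of `c₂ y'` with `c₂ y` feel it, and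
  -- each yields a factor 1/M₂.
  have hc₂ : ∀ (c₁ : 𝒳 → 𝒜 × Fin M₁), ∑ c₂ : 𝒴 → Fin M₂, actionBinWeight Q c₁ * binWeight c₂ *
      (f (c₁ x).1 * confusionBound T c₁ c₂ x y) =
      actionBinWeight Q c₁ * (f (c₁ x).1 * (1 - T x (c₁ x).1 y)) +
      (∑ x', if x = x' then 0 else actionBinWeight Q c₁ * (f (c₁ x).1 *
        ((if (c₁ x').2 = (c₁ x).2 then 1 else 0) * T x' (c₁ x').1 y))) +
      (∑ y', if y = y' then 0 else actionBinWeight Q c₁ * (f (c₁ x).1 * T x (c₁ x).1 y') *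
        (1 / (M₂ : ℝ))) +
      (∑ x', ∑ y', if x = x' then 0 else if y = y' then 0 else (actionBinWeight Q c₁ *
        (f (c₁ x).1 * ((if (c₁ x').2 = (c₁ x).2 then 1 else 0) * T x' (c₁ x').1 y'))) *
        (1 / (M₂ : ℝ))) := by
    intro c₁
    unfold confusionBound
    simp_rw [mul_add, Finset.sum_add_distrib]
    congr 1
    · congr 1
      · congr 1
        · calc _ = (∑ c₂ : 𝒴 → Fin M₂, binWeight c₂) *
              (actionBinWeight Q c₁ * (f (c₁ x).1 * (1 - T x (c₁ x).1 y))) := by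
                rw [Finset.sum_mul]; exact Finset.sum_congr rfl fun _ _ => by ring
            _ = _ := by rw [hbw, one_mul]
        · calc _ = (∑ c₂ : 𝒴 → Fin M₂, binWeight c₂) * (∑ x', if x = x' then 0 else
              actionBinWeight Q c₁ * (f (c₁ x).1 *
              ((if (c₁ x').2 = (c₁ x).2 then 1 else 0) * T x' (c₁ x').1 y))) := by
                rw [Finset.sum_mul]
                refine Finset.sum_congr rfl fun _ _ => ?_
                simp_rw [Finset.mul_sum]
                refine Finset.sum_congr rfl fun x' _ => ?_
                split_ifs <;> ring
            _ = _ := by rw [hbw, one_mul]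
      · simp_rw [Finset.mul_sum]
        rw [Finset.sum_comm]
        refine Finset.sum_congr rfl fun y' _ => ?_
        by_cases hy : y = y'
        · simp [hy]
        · simp only [if_neg hy]
          rw [← mean_bin_collision hM₂ hy, Finset.mul_sum]
          exact Finset.sum_congr rfl fun _ _ => by ring
    · simp_rw [Finset.mul_sum]
      rw [Finset.sum_comm]
      refine Finset.sum_congr rfl fun x' _ => ?_
      rw [Finset.sum_comm]
      refine Finset.sum_congr rfl fun y' _ => ?_
      by_cases hx : x = x'
      · simp [hx]
      by_cases hy : y = y'
      · simp [hx, hy]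
      · simp only [if_neg hx, if_neg hy]
        rw [← mean_bin_collision hM₂ hy, Finset.mul_sum]
        exact Finset.sum_congr rfl fun _ _ => by ring
  simp_rw [hc₂, Finset.sum_add_distrib]
  refine add_le_add (add_le_add (add_le_add ?_ ?_) ?_) ?_
  · exact (mean_actionBin_eval hQ hM₁ x (fun a => f a * (1 - T x a y))).le
  · have h1 : (∑ x', ∑ a', Q x' a' * T x' a' y) * (1 / (M₁ : ℝ)) =
        ∑ x', (∑ a', Q x' a' * T x' a' y) * (1 / (M₁ : ℝ)) := Finset.sum_mul _ _ _
    rw [Finset.sum_comm, h1, Finset.mul_sum]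
    refine Finset.sum_le_sum fun x' _ => ?_
    by_cases hx : x = x'
    · simp only [if_pos hx, Finset.sum_const_zero]
      exact mul_nonneg hfQ (mul_nonneg (Finset.sum_nonneg fun a _ =>
        mul_nonneg ((hQ x').1 a) (hT _ _ _)) hM₁')
    · simp only [if_neg hx]
      exact (mean_actionBin_collision hQ hM₁ hx f (fun a => T x' a y)).le
  · have h1 : ∀ a, f a * ∑ y', T x a y' = ∑ y', f a * T x a y' := fun a => Finset.mul_sum _ _ _
    simp_rw [h1, Finset.mul_sum]
    rw [Finset.sum_comm, Finset.sum_comm (γ := 𝒜), Finset.sum_mul]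
    refine Finset.sum_le_sum fun y' _ => ?_
    by_cases hy : y = y'
    · simp only [if_pos hy, Finset.sum_const_zero]
      exact mul_nonneg (Finset.sum_nonneg fun a _ =>
        mul_nonneg ((hQ x).1 a) (mul_nonneg (hf a) (hT _ _ _))) hM₂'
    · simp only [if_neg hy]
      rw [← Finset.sum_mul]
      exact (congrArg (· * (1 / (M₂ : ℝ)))
        (mean_actionBin_eval hQ hM₁ x (fun a => f a * T x a y'))).le
  · have h0 : (∑ x', ∑ a', Q x' a' * ∑ y', T x' a' y') * (1 / (M₁ : ℝ)) * (1 / (M₂ : ℝ)) =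
        ∑ x', (∑ a', Q x' a' * ∑ y', T x' a' y') * (1 / (M₁ : ℝ)) * (1 / (M₂ : ℝ)) := by
      simp_rw [Finset.sum_mul]
    rw [Finset.sum_comm, h0, Finset.mul_sum]
    refine Finset.sum_le_sum fun x' _ => ?_
    rw [Finset.sum_comm]
    have h1 : ∑ a', Q x' a' * ∑ y', T x' a' y' = ∑ y', ∑ a', Q x' a' * T x' a' y' := by
      simp_rw [Finset.mul_sum]; rw [Finset.sum_comm]
    have h2 : (∑ y', ∑ a', Q x' a' * T x' a' y') * (1 / (M₁ : ℝ)) * (1 / (M₂ : ℝ)) =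
        ∑ y', (∑ a', Q x' a' * T x' a' y') * (1 / (M₁ : ℝ)) * (1 / (M₂ : ℝ)) := by
      simp_rw [Finset.sum_mul]
    rw [h1, h2, Finset.mul_sum]
    refine Finset.sum_le_sum fun y' _ => ?_
    have hnn : 0 ≤ (∑ a, Q x a * f a) *
        ((∑ a', Q x' a' * T x' a' y') * (1 / (M₁ : ℝ)) * (1 / (M₂ : ℝ))) :=
      mul_nonneg hfQ (mul_nonneg (mul_nonneg (Finset.sum_nonneg fun a _ =>
        mul_nonneg ((hQ x').1 a) (hT _ _ _)) hM₁') hM₂')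
    by_cases hx : x = x'
    · simpa only [if_pos hx, Finset.sum_const_zero] using hnn
    by_cases hy : y = y'
    · simpa only [if_neg hx, if_pos hy, Finset.sum_const_zero] using hnn
    · simp only [if_neg hx, if_neg hy]
      rw [← Finset.sum_mul, mean_actionBin_collision hQ hM₁ hx f (fun a => T x' a y')]
      exact le_of_eq (by ring)

/-- One-shot coding with a random strategy and random binning. -/
theorem exists_one_shot_code [Nonempty 𝒳] [Nonempty 𝒴] {P : 𝒳 → ℝ} (hP : P ∈ stdSimplex ℝ 𝒳)
    {Q : 𝒳 → 𝒜 → ℝ} (hQ : ∀ x, Q x ∈ stdSimplex ℝ 𝒜)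
    {W : 𝒳 → 𝒜 → 𝒴 → ℝ} (hW : ∀ x a, W x a ∈ stdSimplex ℝ 𝒴)
    {T : 𝒳 → 𝒜 → 𝒴 → ℝ} (hT : ∀ x a y, T x a y = 0 ∨ T x a y = 1) {K₁ K₂ K₃ : ℝ}
    (hT₁ : ∀ x a y, T x a y = 1 → ∑ x', ∑ a', P x' * Q x' a' * W x' a' y ≤ K₁ * (P x * W x a y))
    (hT₂ : ∀ x a y, T x a y = 1 → 1 ≤ K₂ * W x a y)
    (hT₃ : ∀ x a y, T x a y = 1 → 1 ≤ K₃ * (P x * W x a y))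
    (hK₁ : 0 ≤ K₁) (hK₂ : 0 ≤ K₂) (hK₃ : 0 ≤ K₃)
    {Z : 𝒳 → 𝒜 → ℝ} (hZ : ∀ x a, 0 ≤ Z x a) {M₁ M₂ : ℕ} (hM₁ : 0 < M₁) (hM₂ : 0 < M₂)
    {δ t e : ℝ} (hδ : δ ≤ 1) (ht : 0 ≤ t) (he : 0 < e)
    (hcost : ∑ x, ∑ a, P x * (Q x a * Z x a) ≤ (1 - δ) * t)
    (herr : ∑ x, ∑ a, ∑ y, P x * Q x a * W x a y * (1 - T x a y) + K₁ * (1 / (M₁ : ℝ)) +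
      K₂ * (1 / (M₂ : ℝ)) + K₃ * (1 / (M₁ : ℝ)) * (1 / (M₂ : ℝ)) ≤ δ * e) :
    ∃ (b₁ : 𝒳 → Fin M₁) (b₂ : 𝒴 → Fin M₂) (h : 𝒳 → 𝒜) (dec : Fin M₁ × Fin M₂ → 𝒳 × 𝒴),
      ∑ x, P x * Z x (h x) ≤ t ∧
      (∑ x, ∑ y, if (x, y) ≠ dec (b₁ x, b₂ y) then P x * W x (h x) y else 0) ≤ e := by
  have hM₁' : (0 : ℝ) ≤ 1 / (M₁ : ℝ) := by positivity
  have hM₂' : (0 : ℝ) ≤ 1 / (M₂ : ℝ) := by positivity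
  have hT0 : ∀ x a y, 0 ≤ T x a y := fun x a y => by rcases hT x a y with h | h <;> simp [h]
  have hw₁ := actionBinWeight_mem hQ hM₁
  have hw₂ := binWeight_mem (𝒴 := 𝒴) hM₂
  choose dec hdec using fun c : (𝒳 → 𝒜 × Fin M₁) × (𝒴 → Fin M₂) =>
    exists_decoder_error_le hT c.1 c.2
  suffices h : ∃ c : (𝒳 → 𝒜 × Fin M₁) × (𝒴 → Fin M₂), ∑ x, P x * Z x (c.1 x).1 ≤ t ∧
      (∑ x, ∑ y, if (x, y) ≠ dec c ((c.1 x).2, c.2 y) then P x * W x (c.1 x).1 y else 0) ≤ e by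
    obtain ⟨c, hc₁, hc₂⟩ := h
    exact ⟨fun x => (c.1 x).2, c.2, fun x => (c.1 x).1, dec c, hc₁, hc₂⟩
  -- Derandomisation: some realisation of strategy and bins meets the cost and error targets at
  -- once.
  refine exists_le_and_le_of_mean_le
    (w := fun c : (𝒳 → 𝒜 × Fin M₁) × (𝒴 → Fin M₂) => actionBinWeight Q c.1 * binWeight c.2)
    (Z := fun c => ∑ x, P x * Z x (c.1 x).1)
    (E := fun c => ∑ x, ∑ y, if (x, y) ≠ dec c ((c.1 x).2, c.2 y) then
      P x * W x (c.1 x).1 y else 0) (δ := δ) (t := t) (e := e)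
    ⟨fun c => mul_nonneg (hw₁.1 _) (hw₂.1 _), by
      rw [Fintype.sum_prod_type]
      simp_rw [← Finset.mul_sum, hw₂.2, mul_one]
      exact hw₁.2⟩
    (fun c => Finset.sum_nonneg fun x _ => mul_nonneg (hP.1 x) (hZ _ _))
    (fun c => Finset.sum_nonneg fun x _ => Finset.sum_nonneg fun y _ => by
      split_ifs
      · exact mul_nonneg (hP.1 x) ((hW _ _).1 _)
      · exact le_rfl) hδ ht he ?_ ?_
  · rw [Fintype.sum_prod_type]
    refine le_of_eq_of_le ?_ hcost
    have h1 : ∀ c₁ : 𝒳 → 𝒜 × Fin M₁, ∑ c₂ : 𝒴 → Fin M₂, actionBinWeight Q c₁ * binWeight c₂ *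
        ∑ x, P x * Z x (c₁ x).1 = ∑ x, P x * (actionBinWeight Q c₁ * Z x (c₁ x).1) := by
      intro c₁
      rw [← Finset.sum_mul, ← Finset.mul_sum, hw₂.2, mul_one, Finset.mul_sum]
      exact Finset.sum_congr rfl fun x _ => by ring
    simp_rw [h1]
    rw [Finset.sum_comm]
    refine Finset.sum_congr rfl fun x _ => ?_
    rw [← Finset.mul_sum, mean_actionBin_eval hQ hM₁ x (Z x), Finset.mul_sum]
  · rw [Fintype.sum_prod_type]
    refine le_trans ?_ herr
    have h1 : ∀ (c₁ : 𝒳 → 𝒜 × Fin M₁) (c₂ : 𝒴 → Fin M₂), actionBinWeight Q c₁ * binWeight c₂ *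
        (∑ x, ∑ y, if (x, y) ≠ dec (c₁, c₂) ((c₁ x).2, c₂ y) then P x * W x (c₁ x).1 y else 0) ≤
        ∑ x, ∑ y, P x * (actionBinWeight Q c₁ * binWeight c₂ *
          (W x (c₁ x).1 y * confusionBound T c₁ c₂ x y)) := by
      intro c₁ c₂
      rw [Finset.mul_sum]
      refine Finset.sum_le_sum fun x _ => ?_
      rw [Finset.mul_sum]
      refine Finset.sum_le_sum fun y _ => ?_
      have h2 := hdec (c₁, c₂) x y
      have h3 : (if (x, y) ≠ dec (c₁, c₂) ((c₁ x).2, c₂ y) then P x * W x (c₁ x).1 y else 0)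
          = P x * W x (c₁ x).1 y *
            (if (x, y) ≠ dec (c₁, c₂) ((c₁ x).2, c₂ y) then 1 else 0) := by
        split_ifs <;> simp
      rw [h3]
      calc _ ≤ actionBinWeight Q c₁ * binWeight c₂ *
            (P x * W x (c₁ x).1 y * confusionBound T c₁ c₂ x y) := by
            refine mul_le_mul_of_nonneg_left (mul_le_mul_of_nonneg_left h2
              (mul_nonneg (hP.1 x) ((hW _ _).1 _))) (mul_nonneg (hw₁.1 _) (hw₂.1 _))
        _ = _ := by ring
    refine (Finset.sum_le_sum fun c₁ _ => Finset.sum_le_sum fun c₂ _ => h1 c₁ c₂).trans ?_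
    have h4 : ∑ c₁ : 𝒳 → 𝒜 × Fin M₁, ∑ c₂ : 𝒴 → Fin M₂, ∑ x, ∑ y,
        P x * (actionBinWeight Q c₁ * binWeight c₂ *
          (W x (c₁ x).1 y * confusionBound T c₁ c₂ x y)) =
        ∑ x, ∑ y, P x * ∑ c₁ : 𝒳 → 𝒜 × Fin M₁, ∑ c₂ : 𝒴 → Fin M₂,
          (actionBinWeight Q c₁ * binWeight c₂ *
          (W x (c₁ x).1 y * confusionBound T c₁ c₂ x y)) := by
      simp_rw [Finset.mul_sum]
      rw [Finset.sum_congr rfl fun c₁ _ => Finset.sum_comm, Finset.sum_comm]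
      refine Finset.sum_congr rfl fun x _ => ?_
      rw [Finset.sum_congr rfl fun c₁ _ => Finset.sum_comm, Finset.sum_comm]
    rw [h4]
    refine (Finset.sum_le_sum fun x _ => Finset.sum_le_sum fun y _ => mul_le_mul_of_nonneg_left
      (mean_confusionBound_le hT0 hQ hM₁ hM₂ x y (f := fun a => W x a y)
        fun a => (hW x a).1 y) (hP.1 x)).trans ?_
    simp_rw [mul_add, Finset.sum_add_distrib]
    have hPQ : ∑ x, ∑ a, P x * Q x a = 1 := by
      simp_rw [← Finset.mul_sum, (hQ _).2, mul_one]; exact hP.2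
    have hPQW : ∑ x, ∑ a, ∑ y, P x * Q x a * W x a y = 1 := by
      simp_rw [← Finset.mul_sum, (hW _ _).2, mul_one]; exact hPQ
    have hout : ∀ y, ∑ x, P x * ∑ a, Q x a * W x a y = ∑ x', ∑ a', P x' * Q x' a' * W x' a' y := by
      intro y
      simp_rw [Finset.mul_sum, mul_assoc]
    have houtsum : ∑ y, ∑ x', ∑ a', P x' * Q x' a' * W x' a' y = 1 := by
      rw [← hPQW, Finset.sum_comm]
      refine Finset.sum_congr rfl fun x _ => ?_
      rw [Finset.sum_comm]
    have hnn : ∀ x a y, 0 ≤ P x * Q x a * W x a y := fun x a y =>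
      mul_nonneg (mul_nonneg (hP.1 x) ((hQ x).1 a)) ((hW x a).1 y)
    refine add_le_add (add_le_add (add_le_add ?_ ?_) ?_) ?_
    · refine le_of_eq (Finset.sum_congr rfl fun x _ => ?_)
      rw [Finset.sum_comm]
      refine Finset.sum_congr rfl fun y _ => ?_
      rw [Finset.mul_sum]
      exact Finset.sum_congr rfl fun a _ => by ring
    · rw [Finset.sum_comm]
      -- Averaging over the true source and action turns its likelihood into the output law of `y`.
      -- On the test set, `hT₁` trades this for K₁ times the rival's own likelihood, whose sum is
      -- again the output law.
      have h5 : ∀ y, ∑ x, P x * ((∑ a, Q x a * W x a y) *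
          ((∑ x', ∑ a', Q x' a' * T x' a' y) * (1 / (M₁ : ℝ)))) ≤
          (∑ x', ∑ a', P x' * Q x' a' * W x' a' y) * (K₁ * (1 / (M₁ : ℝ))) := by
        intro y
        calc _ = (∑ x', ∑ a', Q x' a' * (T x' a' y * (∑ x', ∑ a', P x' * Q x' a' * W x' a' y)))
              * (1 / (M₁ : ℝ)) := by
              rw [← hout y]
              generalize hC : (∑ x, P x * ∑ a, Q x a * W x a y) = C
              have h9 : ∑ x', ∑ a', Q x' a' * (T x' a' y * C) =
                  (∑ x', ∑ a', Q x' a' * T x' a' y) * C := by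
                simp_rw [← mul_assoc, ← Finset.sum_mul]
              rw [h9, ← hC]
              simp_rw [← mul_assoc, ← Finset.sum_mul]
              ring
          _ ≤ (∑ x', ∑ a', Q x' a' * (K₁ * (P x' * W x' a' y))) * (1 / (M₁ : ℝ)) := by
              refine mul_le_mul_of_nonneg_right (Finset.sum_le_sum fun x' _ =>
                Finset.sum_le_sum fun a' _ => mul_le_mul_of_nonneg_left ?_ ((hQ x').1 a')) hM₁'
              rcases hT x' a' y with h | h
              · rw [h, zero_mul]
                exact mul_nonneg hK₁ (mul_nonneg (hP.1 _) ((hW _ _).1 _))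
              · rw [h, one_mul]
                exact hT₁ x' a' y h
          _ = _ := by
              rw [← mul_assoc]
              congr 1
              simp_rw [Finset.sum_mul]
              exact Finset.sum_congr rfl fun x' _ => Finset.sum_congr rfl fun a' _ => by ring
      refine (Finset.sum_le_sum fun y _ => h5 y).trans (le_of_eq ?_)
      rw [← Finset.sum_mul, houtsum, one_mul]
    · have h6 : ∀ x y, P x * ((∑ a, Q x a * (W x a y * ∑ y', T x a y')) * (1 / (M₂ : ℝ))) ≤
          (∑ a, P x * Q x a * W x a y) * (K₂ * (1 / (M₂ : ℝ))) := by
        intro x y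
        -- Each `y'` that passes has likelihood at least 1/K₂, so at most K₂ of them pass.
        have h7 : ∀ a, ∑ y', T x a y' ≤ K₂ := by
          intro a
          calc ∑ y', T x a y' ≤ ∑ y', K₂ * W x a y' := by
                refine Finset.sum_le_sum fun y' _ => ?_
                rcases hT x a y' with h | h
                · rw [h]; exact mul_nonneg hK₂ ((hW _ _).1 _)
                · rw [h]; exact hT₂ x a y' h
            _ = K₂ := by rw [← Finset.mul_sum, (hW x a).2, mul_one]
        calc _ ≤ P x * ((∑ a, Q x a * (W x a y * K₂)) * (1 / (M₂ : ℝ))) := by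
              refine mul_le_mul_of_nonneg_left (mul_le_mul_of_nonneg_right
                (Finset.sum_le_sum fun a _ => mul_le_mul_of_nonneg_left
                (mul_le_mul_of_nonneg_left (h7 a) ((hW x a).1 y)) ((hQ x).1 a)) hM₂') (hP.1 x)
          _ = _ := by
              rw [Finset.sum_mul, Finset.sum_mul, Finset.mul_sum]
              exact Finset.sum_congr rfl fun a _ => by ring
      refine (Finset.sum_le_sum fun x _ => Finset.sum_le_sum fun y _ => h6 x y).trans
        (le_of_eq ?_)
      simp_rw [← Finset.sum_mul]
      have : ∑ x, ∑ y, ∑ a, P x * Q x a * W x a y = 1 := by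
        rw [← hPQW]
        exact Finset.sum_congr rfl fun x _ => Finset.sum_comm
      rw [this, one_mul]
    -- The same counting for pairs: those that pass have P W at least 1/K₃.
    · have h8 : ∑ x', ∑ a', Q x' a' * ∑ y', T x' a' y' ≤ K₃ := by
        calc ∑ x', ∑ a', Q x' a' * ∑ y', T x' a' y'
            ≤ ∑ x', ∑ a', Q x' a' * ∑ y', K₃ * (P x' * W x' a' y') := by
              refine Finset.sum_le_sum fun x' _ => Finset.sum_le_sum fun a' _ =>
                mul_le_mul_of_nonneg_left (Finset.sum_le_sum fun y' _ => ?_) ((hQ x').1 a')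
              rcases hT x' a' y' with h | h
              · rw [h]; exact mul_nonneg hK₃ (mul_nonneg (hP.1 _) ((hW _ _).1 _))
              · rw [h]; exact hT₃ x' a' y' h
          _ = K₃ * ∑ x', ∑ a', ∑ y', P x' * Q x' a' * W x' a' y' := by
              simp_rw [Finset.mul_sum]
              exact Finset.sum_congr rfl fun x' _ => Finset.sum_congr rfl fun a' _ =>
                Finset.sum_congr rfl fun y' _ => by ring
          _ = K₃ := by rw [hPQW, mul_one]
      calc _ = (∑ x, ∑ y, P x * ∑ a, Q x a * W x a y) *
            ((∑ x', ∑ a', Q x' a' * ∑ y', T x' a' y') * (1 / (M₁ : ℝ)) * (1 / (M₂ : ℝ))) := by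
            simp_rw [← mul_assoc, ← Finset.sum_mul]
        _ = (∑ x', ∑ a', Q x' a' * ∑ y', T x' a' y') * (1 / (M₁ : ℝ)) * (1 / (M₂ : ℝ)) := by
            rw [Finset.sum_comm, Finset.sum_congr rfl fun y _ => hout y, houtsum, one_mul]
        _ ≤ _ := by gcongr

end RandomBinning

/-! ### Entropies as expectations of log-likelihoods -/

theorem nonempty_of_mem_stdSimplex {Ω : Type*} [Fintype Ω] {p : Ω → ℝ}
    (hp : p ∈ stdSimplex ℝ Ω) : Nonempty Ω := by
  by_contra h
  rw [not_nonempty_iff] at h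
  have := hp.2
  simp at this

section Laws

variable {Ω U V : Type*} [Fintype Ω] [Fintype U] [Fintype V] [DecidableEq U] [DecidableEq V]

theorem sum_law_mul (p : Ω → ℝ) (f : Ω → U) (F : U → ℝ) :
    ∑ u, law p f u * F u = ∑ ω, p ω * F (f ω) := by
  simp_rw [law, Finset.sum_mul]
  rw [Finset.sum_comm]
  simp

theorem condEntropy_eq_sum (p : Ω → ℝ) (f : Ω → U) (g : Ω → V) :
    condEntropy p f g = -∑ ω, p ω *
      Real.logb 2 (law p (fun ω => (f ω, g ω)) (f ω, g ω) / law p g (g ω)) := by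
  have h := sum_law_mul p (fun ω => (f ω, g ω))
    fun z => Real.logb 2 (law p (fun ω => (f ω, g ω)) z / law p g z.2)
  rw [Fintype.sum_prod_type] at h
  rw [condEntropy, h]

theorem mutualInfo_eq_sum (p : Ω → ℝ) (f : Ω → U) (g : Ω → V) :
    mutualInfo p f g = ∑ ω, p ω *
      Real.logb 2 (law p (fun ω => (f ω, g ω)) (f ω, g ω) / (law p f (f ω) * law p g (g ω))) := by
  have h := sum_law_mul p (fun ω => (f ω, g ω))
    fun z => Real.logb 2 (law p (fun ω => (f ω, g ω)) z / (law p f z.1 * law p g z.2))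
  rw [Fintype.sum_prod_type] at h
  rw [mutualInfo, h]

theorem law_pos {p : Ω → ℝ} (hp : ∀ ω, 0 ≤ p ω) (f : Ω → U) {ω : Ω} (hω : 0 < p ω) :
    0 < law p f (f ω) := by
  refine hω.trans_le ?_
  have := Finset.single_le_sum (f := fun ω' => if f ω' = f ω then p ω' else 0)
    (fun ω' _ => by split_ifs <;> simp [hp]) (Finset.mem_univ ω)
  simpa [law] using this

theorem law_of_injective (p : Ω → ℝ) {f : Ω → U} (hf : Function.Injective f) (ω : Ω) :
    law p f (f ω) = p ω := by
  classical
  simp [law, hf.eq_iff]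

end Laws

/-! ### Single-letter bounds as functions of the action law -/

noncomputable section SingleLetter

variable {X A Y : Type*} [Fintype X] [DecidableEq X] [Fintype A] [DecidableEq A]
  [Fintype Y] [DecidableEq Y]

/-- The output distribution induced by the input law `PX` and the action law `Q`. -/
def outLaw (PX : X → ℝ) (Q : X → A → ℝ) (W : X → A → Y → ℝ) (y : Y) : ℝ :=
  ∑ x, ∑ a, PX x * Q x a * W x a y

/-- `H(X) + H(Y|X,A) - H(Y)`. -/
def rateBoundX (PX : X → ℝ) (Q : X → A → ℝ) (W : X → A → Y → ℝ) : ℝ :=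
  ∑ ω, jointLaw PX Q W ω *
    (Real.logb 2 (outLaw PX Q W ω.2.2) - Real.logb 2 (PX ω.1 * W ω.1 ω.2.1 ω.2.2))

/-- `H(Y|X,A)`. -/
def rateBoundY (PX : X → ℝ) (Q : X → A → ℝ) (W : X → A → Y → ℝ) : ℝ :=
  ∑ ω, jointLaw PX Q W ω * (Real.logb 2 1 - Real.logb 2 (W ω.1 ω.2.1 ω.2.2))

/-- `H(X) + H(Y|X,A)`. -/
def rateBoundSum (PX : X → ℝ) (Q : X → A → ℝ) (W : X → A → Y → ℝ) : ℝ :=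
  ∑ ω, jointLaw PX Q W ω * (Real.logb 2 1 - Real.logb 2 (PX ω.1 * W ω.1 ω.2.1 ω.2.2))

variable {PX : X → ℝ} {Q : X → A → ℝ} {W : X → A → Y → ℝ}

theorem jointLaw_nonneg (hPX : PX ∈ stdSimplex ℝ X) (hQ : ∀ x, Q x ∈ stdSimplex ℝ A)
    (hW : ∀ x a, W x a ∈ stdSimplex ℝ Y) (ω : X × A × Y) : 0 ≤ jointLaw PX Q W ω :=
  mul_nonneg (mul_nonneg (hPX.1 _) ((hQ _).1 _)) ((hW _ _).1 _)

theorem sum_jointLaw_mul_eq (hW : ∀ x a, W x a ∈ stdSimplex ℝ Y) (F : X → A → ℝ) :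
    ∑ ω, jointLaw PX Q W ω * F ω.1 ω.2.1 = ∑ x, ∑ a, PX x * Q x a * F x a := by
  simp_rw [Fintype.sum_prod_type, jointLaw]
  refine Finset.sum_congr rfl fun x _ => Finset.sum_congr rfl fun a _ => ?_
  rw [← Finset.sum_mul, ← Finset.mul_sum, (hW x a).2, mul_one]

theorem jointLaw_mem (hPX : PX ∈ stdSimplex ℝ X) (hQ : ∀ x, Q x ∈ stdSimplex ℝ A)
    (hW : ∀ x a, W x a ∈ stdSimplex ℝ Y) : jointLaw PX Q W ∈ stdSimplex ℝ (X × A × Y) := by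
  refine ⟨jointLaw_nonneg hPX hQ hW, ?_⟩
  have h := sum_jointLaw_mul_eq (PX := PX) (Q := Q) hW fun _ _ => 1
  simp only [mul_one] at h
  rw [h]
  simp_rw [← Finset.mul_sum, (hQ _).2, mul_one]
  exact hPX.2

theorem law_source (hQ : ∀ x, Q x ∈ stdSimplex ℝ A) (hW : ∀ x a, W x a ∈ stdSimplex ℝ Y) (x : X) :
    law (jointLaw PX Q W) (fun ω => ω.1) x = PX x := by
  have h := sum_jointLaw_mul_eq (PX := PX) (Q := Q) hW fun x' _ => if x' = x then 1 else 0
  simp only [mul_ite, mul_one, mul_zero] at h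
  rw [law, h, Finset.sum_eq_single x]
  · simp [← Finset.mul_sum, (hQ x).2]
  · intro x' _ hx'; simp [hx']
  · simp

theorem law_source_action (hW : ∀ x a, W x a ∈ stdSimplex ℝ Y) (x : X) (a : A) :
    law (jointLaw PX Q W) (fun ω => (ω.1, ω.2.1)) (x, a) = PX x * Q x a := by
  have h := sum_jointLaw_mul_eq (PX := PX) (Q := Q) hW
    fun x' a' => if (x', a') = (x, a) then 1 else 0
  simp only [mul_ite, mul_one, mul_zero] at h
  rw [law, h, Finset.sum_eq_single x, Finset.sum_eq_single a]
  · simp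
  · intro a' _ ha'; simp [ha']
  · simp
  · intro x' _ hx'; simp [hx']
  · simp

theorem law_output (y : Y) : law (jointLaw PX Q W) (fun ω => ω.2.2) y = outLaw PX Q W y := by
  simp [law, outLaw, jointLaw, Fintype.sum_prod_type]

theorem outLaw_nonneg (hPX : PX ∈ stdSimplex ℝ X) (hQ : ∀ x, Q x ∈ stdSimplex ℝ A)
    (hW : ∀ x a, W x a ∈ stdSimplex ℝ Y) (y : Y) : 0 ≤ outLaw PX Q W y :=
  Finset.sum_nonneg fun x _ => Finset.sum_nonneg fun a _ => jointLaw_nonneg hPX hQ hW (x, a, y)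

theorem sum_outLaw (hPX : PX ∈ stdSimplex ℝ X) (hQ : ∀ x, Q x ∈ stdSimplex ℝ A)
    (hW : ∀ x a, W x a ∈ stdSimplex ℝ Y) : ∑ y, outLaw PX Q W y = 1 := by
  have := sum_law_mul (jointLaw PX Q W) (fun ω => ω.2.2) fun _ => 1
  simpa only [law_output, mul_one, (jointLaw_mem hPX hQ hW).2] using this

/-- The factors of the joint law are positive where it is. -/
theorem factors_pos_of_jointLaw_pos (hPX : PX ∈ stdSimplex ℝ X)
    (hQ : ∀ x, Q x ∈ stdSimplex ℝ A) (hW : ∀ x a, W x a ∈ stdSimplex ℝ Y) {ω : X × A × Y}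
    (hω : 0 < jointLaw PX Q W ω) :
    0 < PX ω.1 ∧ 0 < Q ω.1 ω.2.1 ∧ 0 < W ω.1 ω.2.1 ω.2.2 ∧ 0 < outLaw PX Q W ω.2.2 := by
  have hne := hω.ne'
  simp only [jointLaw, mul_ne_zero_iff] at hne
  refine ⟨(hPX.1 _).lt_of_ne' hne.1.1, ((hQ _).1 _).lt_of_ne' hne.1.2,
    ((hW _ _).1 _).lt_of_ne' hne.2, ?_⟩
  rw [← law_output]
  exact law_pos (jointLaw_nonneg hPX hQ hW) (fun ω => ω.2.2) hω

theorem sum_mul_congr_of_pos {Ω : Type*} [Fintype Ω] {p f g : Ω → ℝ} (hp : ∀ ω, 0 ≤ p ω)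
    (h : ∀ ω, 0 < p ω → f ω = g ω) : ∑ ω, p ω * f ω = ∑ ω, p ω * g ω := by
  refine Finset.sum_congr rfl fun ω _ => ?_
  rcases (hp ω).eq_or_lt with h0 | h0
  · rw [← h0]; simp
  · rw [h ω h0]

/-- Pointwise on the support, the laws of A and of (Y,A) cancel between the three terms, and the
factor `Q` of the joint law cancels against that of the law of (X,A). -/
theorem bound_X_eq (hPX : PX ∈ stdSimplex ℝ X) (hQ : ∀ x, Q x ∈ stdSimplex ℝ A)
    (hW : ∀ x a, W x a ∈ stdSimplex ℝ Y) :
    condEntropy (jointLaw PX Q W) (fun ω => ω.1) (fun ω => (ω.2.2, ω.2.1)) +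
      mutualInfo (jointLaw PX Q W) (fun ω => ω.1) (fun ω => ω.2.1) -
      mutualInfo (jointLaw PX Q W) (fun ω => ω.2.2) (fun ω => ω.2.1) = rateBoundX PX Q W := by
  rw [condEntropy_eq_sum, mutualInfo_eq_sum, mutualInfo_eq_sum, ← Finset.sum_neg_distrib,
    ← Finset.sum_add_distrib, ← Finset.sum_sub_distrib, rateBoundX]
  simp_rw [← mul_neg, ← mul_add, ← mul_sub]
  have hp := jointLaw_nonneg hPX hQ hW
  refine sum_mul_congr_of_pos hp fun ω hω => ?_
  obtain ⟨h1, h2, h3, h4⟩ := factors_pos_of_jointLaw_pos hPX hQ hW hω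
  have hA := law_pos hp (fun ω => ω.2.1) hω
  have hYA := law_pos hp (fun ω => (ω.2.2, ω.2.1)) hω
  have hinj : Function.Injective fun ω : X × A × Y => (ω.1, ω.2.2, ω.2.1) := by
    rintro ⟨x, a, y⟩ ⟨x', a', y'⟩ h; simp at h; simp [h]
  rw [law_of_injective (jointLaw PX Q W) hinj, law_source hQ hW, law_source_action hW, law_output,
    Real.logb_div hω.ne' hYA.ne', Real.logb_div (by positivity) (by positivity),
    Real.logb_div hYA.ne' (by positivity), Real.logb_mul h1.ne' hA.ne', Real.logb_mul h4.ne' hA.ne',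
    jointLaw, Real.logb_mul (by positivity) h3.ne', Real.logb_mul h1.ne' h3.ne']
  ring

theorem bound_Y_eq (hPX : PX ∈ stdSimplex ℝ X) (hQ : ∀ x, Q x ∈ stdSimplex ℝ A)
    (hW : ∀ x a, W x a ∈ stdSimplex ℝ Y) :
    condEntropy (jointLaw PX Q W) (fun ω => ω.2.2) (fun ω => (ω.1, ω.2.1)) =
      rateBoundY PX Q W := by
  rw [condEntropy_eq_sum, ← Finset.sum_neg_distrib, rateBoundY]
  simp_rw [← mul_neg]
  have hp := jointLaw_nonneg hPX hQ hW
  refine sum_mul_congr_of_pos hp fun ω hω => ?_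
  obtain ⟨h1, h2, h3, h4⟩ := factors_pos_of_jointLaw_pos hPX hQ hW hω
  have hinj : Function.Injective fun ω : X × A × Y => (ω.2.2, ω.1, ω.2.1) := by
    rintro ⟨x, a, y⟩ ⟨x', a', y'⟩ h; simp at h; simp [h]
  rw [law_of_injective (jointLaw PX Q W) hinj, law_source_action hW,
    Real.logb_div hω.ne' (by positivity),
    jointLaw, Real.logb_mul (by positivity) h3.ne', Real.logb_one]
  ring

theorem bound_sum_eq (hPX : PX ∈ stdSimplex ℝ X) (hQ : ∀ x, Q x ∈ stdSimplex ℝ A)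
    (hW : ∀ x a, W x a ∈ stdSimplex ℝ Y) :
    condEntropy (jointLaw PX Q W) (fun ω => (ω.1, ω.2.2)) (fun ω => ω.2.1) +
      mutualInfo (jointLaw PX Q W) (fun ω => ω.1) (fun ω => ω.2.1) = rateBoundSum PX Q W := by
  rw [condEntropy_eq_sum, mutualInfo_eq_sum, ← Finset.sum_neg_distrib,
    ← Finset.sum_add_distrib, rateBoundSum]
  simp_rw [← mul_neg, ← mul_add]
  have hp := jointLaw_nonneg hPX hQ hW
  refine sum_mul_congr_of_pos hp fun ω hω => ?_
  obtain ⟨h1, h2, h3, h4⟩ := factors_pos_of_jointLaw_pos hPX hQ hW hω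
  have hA := law_pos hp (fun ω => ω.2.1) hω
  have hinj : Function.Injective fun ω : X × A × Y => ((ω.1, ω.2.2), ω.2.1) := by
    rintro ⟨x, a, y⟩ ⟨x', a', y'⟩ h; simp at h; simp [h]
  rw [law_of_injective (jointLaw PX Q W) hinj, law_source hQ hW, law_source_action hW,
    Real.logb_div hω.ne' hA.ne', Real.logb_div (by positivity) (by positivity),
    Real.logb_mul h1.ne' hA.ne',
    jointLaw, Real.logb_mul (by positivity) h3.ne', Real.logb_mul h1.ne' h3.ne',
    Real.logb_mul h1.ne' h2.ne', Real.logb_one]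
  ring

theorem mem_singleLetterTriplets_iff (hPX : PX ∈ stdSimplex ℝ X)
    (hW : ∀ x a, W x a ∈ stdSimplex ℝ Y) {Λ : A → ℝ} {t : ℝ × ℝ × ℝ} :
    t ∈ singleLetterTriplets PX W Λ ↔ ∃ Q : X → A → ℝ, (∀ x, Q x ∈ stdSimplex ℝ A) ∧
      ∑ ω, jointLaw PX Q W ω * Λ ω.2.1 ≤ t.2.2 ∧ 0 ≤ t.1 ∧ 0 ≤ t.2.1 ∧
      rateBoundX PX Q W ≤ t.1 ∧ rateBoundY PX Q W ≤ t.2.1 ∧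
      rateBoundSum PX Q W ≤ t.1 + t.2.1 := by
  refine exists_congr fun Q => and_congr_right fun hQ => ?_
  simp only [bound_X_eq hPX hQ hW, bound_Y_eq hPX hQ hW, bound_sum_eq hPX hQ hW]

/-! ### The single-letter region is closed and convex -/

/-- Isolates -H(Y), the only part not affine in `Q`, in the form t log t, which is continuous and
convex up to t = 0. -/
theorem rateBoundX_eq_add :
    rateBoundX PX Q W = (∑ y, outLaw PX Q W y * Real.log (outLaw PX Q W y)) / Real.log 2 +
      rateBoundSum PX Q W := by
  have h := sum_law_mul (jointLaw PX Q W) (fun ω => ω.2.2)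
    fun y => Real.logb 2 (outLaw PX Q W y)
  simp only [law_output] at h
  have h2 : (∑ y, outLaw PX Q W y * Real.log (outLaw PX Q W y)) / Real.log 2 =
      ∑ y, outLaw PX Q W y * Real.logb 2 (outLaw PX Q W y) := by
    rw [Finset.sum_div]
    exact Finset.sum_congr rfl fun y _ => by rw [Real.logb]; ring
  rw [h2, h, rateBoundX, rateBoundSum, ← Finset.sum_add_distrib]
  refine Finset.sum_congr rfl fun ω _ => ?_
  rw [Real.logb_one]; ring

theorem continuous_jointLaw (ω : X × A × Y) : Continuous fun Q => jointLaw PX Q W ω := by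
  unfold jointLaw; fun_prop

theorem continuous_sum_jointLaw_mul (F : X × A × Y → ℝ) :
    Continuous fun Q => ∑ ω, jointLaw PX Q W ω * F ω :=
  continuous_finsetSum _ fun ω _ => (continuous_jointLaw ω).mul_const _

theorem continuous_rateBoundX : Continuous fun Q => rateBoundX PX Q W := by
  simp_rw [rateBoundX_eq_add]
  refine Continuous.add (Continuous.div_const (continuous_finsetSum _ fun y _ => ?_) _)
    (continuous_sum_jointLaw_mul _)
  have h : Continuous fun Q => outLaw PX Q W y := by unfold outLaw; fun_prop
  exact Real.continuous_mul_log.comp h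

/-- The conditions are closed jointly in the triplet and `Q`, and projection along the compact set
of action laws is a closed map. -/
theorem isClosed_singleLetterTriplets (hPX : PX ∈ stdSimplex ℝ X)
    (hW : ∀ x a, W x a ∈ stdSimplex ℝ Y) (Λ : A → ℝ) :
    IsClosed (singleLetterTriplets PX W Λ) := by
  have hK : IsCompact (Set.univ.pi fun _ : X => stdSimplex ℝ A) :=
    isCompact_univ_pi fun _ => isCompact_stdSimplex ℝ A
  have := isCompact_iff_compactSpace.1 hK
  have hS : singleLetterTriplets PX W Λ = Prod.fst ''
      {z : (ℝ × ℝ × ℝ) × (Set.univ.pi fun _ : X => stdSimplex ℝ A) |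
        ∑ ω, jointLaw PX z.2.1 W ω * Λ ω.2.1 ≤ z.1.2.2 ∧ 0 ≤ z.1.1 ∧ 0 ≤ z.1.2.1 ∧
        rateBoundX PX z.2.1 W ≤ z.1.1 ∧ rateBoundY PX z.2.1 W ≤ z.1.2.1 ∧
        rateBoundSum PX z.2.1 W ≤ z.1.1 + z.1.2.1} := by
    ext t
    rw [mem_singleLetterTriplets_iff hPX hW]
    constructor
    · rintro ⟨Q, hQ, h⟩
      exact ⟨(t, ⟨Q, fun x _ => hQ x⟩), h, rfl⟩
    · rintro ⟨⟨t', Q, hQ⟩, h, rfl⟩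
      exact ⟨Q, fun x => hQ x trivial, h⟩
  rw [hS]
  refine isClosedMap_fst_of_compactSpace _ ?_
  have hq : Continuous fun z : (ℝ × ℝ × ℝ) × (Set.univ.pi fun _ : X => stdSimplex ℝ A) => z.2.1 :=
    continuous_subtype_val.comp continuous_snd
  have hX : Continuous fun z : (ℝ × ℝ × ℝ) × (Set.univ.pi fun _ : X => stdSimplex ℝ A) =>
    rateBoundX PX z.2.1 W := continuous_rateBoundX.comp hq
  have hY : Continuous fun z : (ℝ × ℝ × ℝ) × (Set.univ.pi fun _ : X => stdSimplex ℝ A) =>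
    rateBoundY PX z.2.1 W := (continuous_sum_jointLaw_mul _).comp hq
  have hsum : Continuous fun z : (ℝ × ℝ × ℝ) × (Set.univ.pi fun _ : X => stdSimplex ℝ A) =>
    rateBoundSum PX z.2.1 W := (continuous_sum_jointLaw_mul _).comp hq
  have hΛ : Continuous fun z : (ℝ × ℝ × ℝ) × (Set.univ.pi fun _ : X => stdSimplex ℝ A) =>
    ∑ ω, jointLaw PX z.2.1 W ω * Λ ω.2.1 := (continuous_sum_jointLaw_mul _).comp hq
  simp only [Set.ofPred_and]
  refine IsClosed.inter ?_ (IsClosed.inter ?_ (IsClosed.inter ?_ (IsClosed.inter ?_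
    (IsClosed.inter ?_ ?_)))) <;> exact isClosed_le (by fun_prop) (by fun_prop)

theorem sum_jointLaw_mul_combo (Q Q' : X → A → ℝ) (s t : ℝ) (F : X × A × Y → ℝ) :
    ∑ ω, jointLaw PX (s • Q + t • Q') W ω * F ω =
      s * ∑ ω, jointLaw PX Q W ω * F ω + t * ∑ ω, jointLaw PX Q' W ω * F ω := by
  rw [Finset.mul_sum, Finset.mul_sum, ← Finset.sum_add_distrib]
  refine Finset.sum_congr rfl fun ω _ => ?_
  simp [jointLaw]; ring

theorem outLaw_combo (Q Q' : X → A → ℝ) (s t : ℝ) (y : Y) :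
    outLaw PX (s • Q + t • Q') W y = s * outLaw PX Q W y + t * outLaw PX Q' W y := by
  simp_rw [outLaw, Finset.mul_sum, ← Finset.sum_add_distrib]
  refine Finset.sum_congr rfl fun x _ => Finset.sum_congr rfl fun a _ => ?_
  simp; ring

theorem simplex_combo {Q Q' : X → A → ℝ} (hQ : ∀ x, Q x ∈ stdSimplex ℝ A)
    (hQ' : ∀ x, Q' x ∈ stdSimplex ℝ A) {s t : ℝ} (hs : 0 ≤ s) (ht : 0 ≤ t) (hst : s + t = 1)
    (x : X) : (s • Q + t • Q') x ∈ stdSimplex ℝ A :=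
  convex_stdSimplex ℝ A (hQ x) (hQ' x) hs ht hst

/-- The output law is affine in `Q` and t log t is convex. -/
theorem rateBoundX_combo_le (hPX : PX ∈ stdSimplex ℝ X) (hW : ∀ x a, W x a ∈ stdSimplex ℝ Y)
    {Q Q' : X → A → ℝ} (hQ : ∀ x, Q x ∈ stdSimplex ℝ A) (hQ' : ∀ x, Q' x ∈ stdSimplex ℝ A)
    {s t : ℝ} (hs : 0 ≤ s) (ht : 0 ≤ t) (hst : s + t = 1) :
    rateBoundX PX (s • Q + t • Q') W ≤ s * rateBoundX PX Q W + t * rateBoundX PX Q' W := by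
  simp_rw [rateBoundX_eq_add]
  have h1 : rateBoundSum PX (s • Q + t • Q') W = s * rateBoundSum PX Q W +
    t * rateBoundSum PX Q' W := sum_jointLaw_mul_combo _ _ _ _ _
  have h2 : ∑ y, outLaw PX (s • Q + t • Q') W y * Real.log (outLaw PX (s • Q + t • Q') W y) ≤
      s * ∑ y, outLaw PX Q W y * Real.log (outLaw PX Q W y) +
      t * ∑ y, outLaw PX Q' W y * Real.log (outLaw PX Q' W y) := by
    rw [Finset.mul_sum, Finset.mul_sum, ← Finset.sum_add_distrib]
    refine Finset.sum_le_sum fun y _ => ?_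
    rw [outLaw_combo]
    exact Real.convexOn_mul_log.2 (outLaw_nonneg hPX hQ hW y) (outLaw_nonneg hPX hQ' hW y) hs ht hst
  have h3 := div_le_div_of_nonneg_right h2 (Real.log_nonneg one_le_two)
  rw [h1]
  rw [add_div, mul_div_assoc, mul_div_assoc] at h3
  linarith

/-- The mixture of two action laws serves the mixture of the rate pairs, so no time-sharing variable
is needed. -/
theorem convex_singleLetter_slice (hPX : PX ∈ stdSimplex ℝ X) (hW : ∀ x a, W x a ∈ stdSimplex ℝ Y)
    (Λ : A → ℝ) (Γ : ℝ) :
    Convex ℝ {r : ℝ × ℝ | (r.1, r.2, Γ) ∈ singleLetterTriplets PX W Λ} := by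
  rintro r hr r' hr' s t hs ht hst
  simp only [Set.mem_ofPred_eq, mem_singleLetterTriplets_iff hPX hW] at hr hr' ⊢
  obtain ⟨Q, hQ, h1, h2, h3, h4, h5, h6⟩ := hr
  obtain ⟨Q', hQ', h1', h2', h3', h4', h5', h6'⟩ := hr'
  refine ⟨s • Q + t • Q', simplex_combo hQ hQ' hs ht hst, ?_, ?_, ?_, ?_, ?_, ?_⟩
  · rw [sum_jointLaw_mul_combo]
    calc _ ≤ s * Γ + t * Γ := by gcongr
      _ = Γ := by rw [← add_mul, hst, one_mul]
  · simp only [Prod.fst_add, Prod.smul_fst, smul_eq_mul]; positivity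
  · simp only [Prod.snd_add, Prod.smul_snd, smul_eq_mul]; positivity
  · simp only [Prod.fst_add, Prod.smul_fst, smul_eq_mul]
    exact (rateBoundX_combo_le hPX hW hQ hQ' hs ht hst).trans (by gcongr)
  · simp only [Prod.snd_add, Prod.smul_snd, smul_eq_mul]
    refine (sum_jointLaw_mul_combo _ _ _ _ _).le.trans ?_
    unfold rateBoundY at h5 h5'
    gcongr
  · simp only [Prod.fst_add, Prod.smul_fst, Prod.snd_add, Prod.smul_snd, smul_eq_mul]
    refine (sum_jointLaw_mul_combo _ _ _ _ _).le.trans ?_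
    unfold rateBoundSum at h6 h6'
    calc _ ≤ s * (r.1 + r.2) + t * (r'.1 + r'.2) := by gcongr
      _ = _ := by ring

end SingleLetter

/-! ### Achievability -/

noncomputable section Achievability

variable {X A Y : Type*} [Fintype X] [DecidableEq X] [Fintype A] [DecidableEq A]
  [Fintype Y] [DecidableEq Y]

theorem sum_arrow_triple {n : ℕ} (F : (Fin n → X) → (Fin n → A) → (Fin n → Y) → ℝ) :
    ∑ ω : Fin n → X × A × Y, F (fun i => (ω i).1) (fun i => (ω i).2.1) (fun i => (ω i).2.2) =
      ∑ x, ∑ a, ∑ y, F x a y := by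
  let e : (Fin n → X × A × Y) ≃ (Fin n → X) × (Fin n → A) × (Fin n → Y) :=
    { toFun := fun ω => (fun i => (ω i).1, fun i => (ω i).2.1, fun i => (ω i).2.2)
      invFun := fun z i => (z.1 i, z.2.1 i, z.2.2 i)
      left_inv := fun _ => rfl
      right_inv := fun _ => rfl }
  have h := Fintype.sum_equiv e
    (fun ω => F (fun i => (ω i).1) (fun i => (ω i).2.1) (fun i => (ω i).2.2))
    (fun z => F z.1 z.2.1 z.2.2) fun _ => rfl
  rw [h, Fintype.sum_prod_type]
  simp_rw [Fintype.sum_prod_type]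

/-- The memoryless extension of the conditional law `Q` of the actions. -/
def actionProb (Q : X → A → ℝ) {n : ℕ} (x : Fin n → X) (a : Fin n → A) : ℝ :=
  ∏ i, Q (x i) (a i)

variable {PX : X → ℝ} {Q : X → A → ℝ} {W : X → A → Y → ℝ}

theorem sourceProb_mem (hPX : PX ∈ stdSimplex ℝ X) {n : ℕ} :
    (sourceProb PX : (Fin n → X) → ℝ) ∈ stdSimplex ℝ (Fin n → X) :=
  ⟨fun _ => Finset.prod_nonneg fun _ _ => hPX.1 _,
    sum_pi_prod_eq_one (q := fun _ => PX) fun _ => hPX.2⟩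

theorem actionProb_mem (hQ : ∀ x, Q x ∈ stdSimplex ℝ A) {n : ℕ} (x : Fin n → X) :
    actionProb Q x ∈ stdSimplex ℝ (Fin n → A) :=
  ⟨fun _ => Finset.prod_nonneg fun _ _ => (hQ _).1 _,
    sum_pi_prod_eq_one (q := fun i => Q (x i)) fun _ => (hQ _).2⟩

theorem channelProb_mem (hW : ∀ x a, W x a ∈ stdSimplex ℝ Y) {n : ℕ} (x : Fin n → X)
    (a : Fin n → A) : channelProb W x a ∈ stdSimplex ℝ (Fin n → Y) :=
  ⟨fun _ => Finset.prod_nonneg fun _ _ => (hW _ _).1 _,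
    sum_pi_prod_eq_one (q := fun i => W (x i) (a i)) fun _ => (hW _ _).2⟩

/-- Under the random strategy the output block is i.i.d., so the block test against the output law
is a product of single-letter ratios. -/
theorem sum_prod_outLaw {n : ℕ} (y : Fin n → Y) :
    ∑ x : Fin n → X, ∑ a : Fin n → A, sourceProb PX x * actionProb Q x a * channelProb W x a y =
      ∏ i, outLaw PX Q W (y i) := by
  simp_rw [sourceProb, actionProb, channelProb, ← Finset.prod_mul_distrib]
  simp_rw [fun x : Fin n → X =>
    sum_pi_prod (fun (i : Fin n) (a : A) => PX (x i) * Q (x i) a * W (x i) a (y i))]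
  rw [sum_pi_prod (fun (i : Fin n) (x : X) => ∑ a, PX x * Q x a * W x a (y i))]
  rfl

theorem mean_sum_eval {β : Type*} [Fintype β] {n : ℕ} {q : Fin n → β → ℝ}
    (hq : ∀ j, ∑ b, q j b = 1) (F : Fin n → β → ℝ) :
    ∑ h : Fin n → β, (∏ j, q j (h j)) * ∑ i, F i (h i) = ∑ i, ∑ b, q i b * F i b := by
  simp_rw [Finset.mul_sum]
  rw [Finset.sum_comm]
  exact Finset.sum_congr rfl fun i _ => sum_pi_prod_mul_eval hq i (F i)

theorem mean_action_cost (hPX : PX ∈ stdSimplex ℝ X) (hQ : ∀ x, Q x ∈ stdSimplex ℝ A) {n : ℕ}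
    (F : A → ℝ) :
    ∑ x : Fin n → X, ∑ a : Fin n → A, sourceProb PX x *
      (actionProb Q x a * (1 / (n : ℝ) * ∑ i, F (a i))) =
      1 / (n : ℝ) * (n * ∑ x, ∑ a, PX x * Q x a * F a) := by
  have h1 : ∀ x : Fin n → X, ∑ a : Fin n → A, sourceProb PX x *
      (actionProb Q x a * (1 / (n : ℝ) * ∑ i, F (a i))) =
      1 / (n : ℝ) * (sourceProb PX x * ∑ i, ∑ b, Q (x i) b * F b) := by
    intro x
    rw [← mean_sum_eval (q := fun i => Q (x i)) (fun _ => (hQ _).2) (fun _ => F), Finset.mul_sum,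
      Finset.mul_sum]
    exact Finset.sum_congr rfl fun a _ => by rw [actionProb]; ring
  simp_rw [h1]
  rw [← Finset.mul_sum]
  have h2 := mean_sum_eval (q := fun _ : Fin n => PX) (fun _ => hPX.2)
    (fun _ x => ∑ b, Q x b * F b)
  unfold sourceProb
  rw [h2]
  simp [Finset.mul_sum, mul_assoc]

theorem exists_tail_bound (hPX : PX ∈ stdSimplex ℝ X) (hQ : ∀ x, Q x ∈ stdSimplex ℝ A)
    (hW : ∀ x a, W x a ∈ stdSimplex ℝ Y) {g d : X × A × Y → ℝ}
    (hg : ∀ ω, 0 < jointLaw PX Q W ω → 0 < g ω) (hd : ∀ ω, 0 < jointLaw PX Q W ω → 0 < d ω) {r : ℝ}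
    (hr : ∑ ω, jointLaw PX Q W ω * (Real.logb 2 (d ω) - Real.logb 2 (g ω)) < r) :
    ∃ ρ : ℝ, 0 ≤ ρ ∧ ρ < 1 ∧ ∀ n : ℕ, ∑ x : Fin n → X, ∑ a : Fin n → A, ∑ y : Fin n → Y,
      sourceProb PX x * actionProb Q x a * channelProb W x a y *
        (if (2 : ℝ) ^ ((n : ℝ) * r) * ∏ i, g (x i, a i, y i) < ∏ i, d (x i, a i, y i) then 1
          else 0) ≤ ρ ^ n := by
  obtain ⟨ρ, h0, h1, h2⟩ := exists_geometric_tail_bound (jointLaw_mem hPX hQ hW) hg hd hr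
  refine ⟨ρ, h0, h1, fun n => le_of_eq_of_le ?_ (h2 n)⟩
  rw [← sum_arrow_triple]
  refine Finset.sum_congr rfl fun ω _ => ?_
  simp only [sourceProb, actionProb, channelProb, ← Finset.prod_mul_distrib, jointLaw]

theorem floor_two_rpow_pos {R : ℝ} (hR : 0 ≤ R) (n : ℕ) :
    0 < ⌊(2 : ℝ) ^ ((n : ℝ) * R)⌋₊ :=
  Nat.floor_pos.2 (Real.one_le_rpow one_le_two (by positivity))

/-- The factor 2 pays for the floor: t < ⌊t⌋ + 1 ≤ 2⌊t⌋ once ⌊t⌋ ≥ 1. -/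
theorem one_div_floor_le {R : ℝ} (hR : 0 ≤ R) (n : ℕ) :
    1 / (⌊(2 : ℝ) ^ ((n : ℝ) * R)⌋₊ : ℝ) ≤ 2 * (2 : ℝ) ^ (-((n : ℝ) * R)) := by
  have h1 : (1 : ℝ) ≤ ⌊(2 : ℝ) ^ ((n : ℝ) * R)⌋₊ := by exact_mod_cast floor_two_rpow_pos hR n
  have h2 := Nat.lt_floor_add_one ((2 : ℝ) ^ ((n : ℝ) * R))
  have h3 : (0 : ℝ) < (2 : ℝ) ^ ((n : ℝ) * R) := Real.rpow_pos_of_pos two_pos _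
  rw [Real.rpow_neg two_pos.le, ← div_eq_mul_inv, div_le_div_iff₀ (by linarith) h3]
  linarith

theorem rpow_mul_rpow_neg (r R : ℝ) (n : ℕ) :
    (2 : ℝ) ^ ((n : ℝ) * r) * (2 : ℝ) ^ (-((n : ℝ) * R)) = ((2 : ℝ) ^ (r - R)) ^ n := by
  rw [← Real.rpow_add two_pos, ← Real.rpow_mul_natCast two_pos.le]
  congr 1; ring

/-- Each threshold rᵢ lies strictly between a bound and a rate. The gap to the bound makes the true
pair pass the test, and the gap to the rate makes rivals rare. The slack δ is fixed while the error
decays, so dividing by it is harmless. -/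
theorem achievable_of_rateBounds_lt (hPX : PX ∈ stdSimplex ℝ X) (hQ : ∀ x, Q x ∈ stdSimplex ℝ A)
    (hW : ∀ x a, W x a ∈ stdSimplex ℝ Y) {Λ : A → ℝ} {m δ Γ : ℝ} (hm : ∀ a, m ≤ Λ a)
    (hΓ : m ≤ Γ) (hδ0 : 0 < δ) (hδ1 : δ ≤ 1)
    (hcost : ∑ ω, jointLaw PX Q W ω * Λ ω.2.1 - m ≤ (1 - δ) * (Γ - m)) {RX RY : ℝ}
    (hRX : 0 ≤ RX) (hRY : 0 ≤ RY) (hX : rateBoundX PX Q W < RX) (hY : rateBoundY PX Q W < RY)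
    (hS : rateBoundSum PX Q W < RX + RY) : Achievable PX W Λ Γ (RX, RY) := by
  obtain ⟨r₁, h₁, hr₁⟩ := exists_between hX
  obtain ⟨r₂, h₂, hr₂⟩ := exists_between hY
  obtain ⟨r₃, h₃, hr₃⟩ := exists_between hS
  have hfac := fun ω => factors_pos_of_jointLaw_pos (ω := ω) hPX hQ hW
  obtain ⟨ρ₁, hρ₁, hρ₁', tail₁⟩ := exists_tail_bound hPX hQ hW
    (fun ω hω => mul_pos (hfac ω hω).1 (hfac ω hω).2.2.1) (fun ω hω => (hfac ω hω).2.2.2) h₁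
  obtain ⟨ρ₂, hρ₂, hρ₂', tail₂⟩ := exists_tail_bound hPX hQ hW (d := fun _ => 1)
    (fun ω hω => (hfac ω hω).2.2.1) (fun ω hω => one_pos) h₂
  obtain ⟨ρ₃, hρ₃, hρ₃', tail₃⟩ := exists_tail_bound hPX hQ hW (d := fun _ => 1)
    (fun ω hω => mul_pos (hfac ω hω).1 (hfac ω hω).2.2.1) (fun ω hω => one_pos) h₃
  set β₁ : ℝ := 2 ^ (r₁ - RX) with hβ₁
  set β₂ : ℝ := 2 ^ (r₂ - RY) with hβ₂
  set β₃ : ℝ := 2 ^ (r₃ - (RX + RY)) with hβ₃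
  have hβ₁0 : 0 < β₁ := Real.rpow_pos_of_pos two_pos _
  have hβ₂0 : 0 < β₂ := Real.rpow_pos_of_pos two_pos _
  have hβ₃0 : 0 < β₃ := Real.rpow_pos_of_pos two_pos _
  have hβ₁' : β₁ < 1 := Real.rpow_lt_one_of_one_lt_of_neg one_lt_two (by linarith)
  have hβ₂' : β₂ < 1 := Real.rpow_lt_one_of_one_lt_of_neg one_lt_two (by linarith)
  have hβ₃' : β₃ < 1 := Real.rpow_lt_one_of_one_lt_of_neg one_lt_two (by linarith)
  -- Three tail terms and three rival terms; the coefficients 2, 2, 4 come from the floors in the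
  -- message counts.
  set e : ℕ → ℝ := fun n =>
    (ρ₁ ^ n + ρ₂ ^ n + ρ₃ ^ n + 2 * β₁ ^ n + 2 * β₂ ^ n + 4 * β₃ ^ n) / δ with he
  have he0 : ∀ n, 0 < e n := fun n => by positivity
  have hlim : Tendsto e atTop (𝓝 0) := by
    have hp := fun {c : ℝ} (h0 : 0 ≤ c) (h1 : c < 1) => tendsto_pow_atTop_nhds_zero_of_lt_one h0 h1
    have := ((((((hp hρ₁ hρ₁').add (hp hρ₂ hρ₂')).add (hp hρ₃ hρ₃')).add
      ((hp hβ₁0.le hβ₁').const_mul 2)).add ((hp hβ₂0.le hβ₂').const_mul 2)).add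
      ((hp hβ₃0.le hβ₃').const_mul 4)).div_const δ
    simpa using this
  have hXne : Nonempty X := nonempty_of_mem_stdSimplex hPX
  obtain ⟨x₀⟩ := id hXne
  have hAne : Nonempty A := nonempty_of_mem_stdSimplex (hQ x₀)
  obtain ⟨a₀⟩ := id hAne
  have hYne : Nonempty Y := nonempty_of_mem_stdSimplex (hW x₀ a₀)
  suffices hcode : ∀ n : ℕ, ∃ c : ActionCode X A Y RX RY n,
      (1 ≤ n → c.expectedCost PX Λ ≤ Γ) ∧ c.errorProb PX W ≤ e n by
    choose c hc using hcode
    refine ⟨c, fun n hn => (hc n).1 hn, squeeze_zero (fun n => ?_) (fun n => (hc n).2) hlim⟩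
    refine Finset.sum_nonneg fun x _ => Finset.sum_nonneg fun y _ => ?_
    split_ifs
    · exact mul_nonneg ((sourceProb_mem hPX).1 _) ((channelProb_mem hW _ _).1 _)
    · exact le_rfl
  intro n
  classical
  set T : (Fin n → X) → (Fin n → A) → (Fin n → Y) → ℝ := fun x a y =>
    if (∏ i, outLaw PX Q W (y i) ≤ (2 : ℝ) ^ ((n : ℝ) * r₁) * ∏ i, PX (x i) * W (x i) (a i) (y i)) ∧
      (∏ _i : Fin n, (1 : ℝ) ≤ (2 : ℝ) ^ ((n : ℝ) * r₂) * ∏ i, W (x i) (a i) (y i)) ∧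
      (∏ _i : Fin n, (1 : ℝ) ≤ (2 : ℝ) ^ ((n : ℝ) * r₃) * ∏ i, PX (x i) * W (x i) (a i) (y i))
    then 1 else 0 with hT
  have hT1 : ∀ x a y, T x a y = 1 →
      (∏ i, outLaw PX Q W (y i) ≤
        (2 : ℝ) ^ ((n : ℝ) * r₁) * ∏ i, PX (x i) * W (x i) (a i) (y i)) ∧
      (∏ _i : Fin n, (1 : ℝ) ≤ (2 : ℝ) ^ ((n : ℝ) * r₂) * ∏ i, W (x i) (a i) (y i)) ∧
      (∏ _i : Fin n, (1 : ℝ) ≤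
        (2 : ℝ) ^ ((n : ℝ) * r₃) * ∏ i, PX (x i) * W (x i) (a i) (y i)) := by
    intro x a y h
    by_contra hn
    simp only [hT, if_neg hn] at h
    exact zero_ne_one h
  have hK : ∀ r : ℝ, (0 : ℝ) ≤ (2 : ℝ) ^ ((n : ℝ) * r) := fun r => by positivity
  have htail : ∑ x : Fin n → X, ∑ a : Fin n → A, ∑ y : Fin n → Y, sourceProb PX x *
      actionProb Q x a * channelProb W x a y * (1 - T x a y) ≤ ρ₁ ^ n + ρ₂ ^ n + ρ₃ ^ n := by
    refine le_trans ?_ (add_le_add (add_le_add (tail₁ n) (tail₂ n)) (tail₃ n))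
    simp_rw [← Finset.sum_add_distrib, ← mul_add]
    refine Finset.sum_le_sum fun x _ => Finset.sum_le_sum fun a _ => Finset.sum_le_sum fun y _ =>
      mul_le_mul_of_nonneg_left ?_ (mul_nonneg (mul_nonneg ((sourceProb_mem hPX).1 _)
        ((actionProb_mem hQ _).1 _)) ((channelProb_mem hW _ _).1 _))
    simp only [hT]
    by_cases c₁ : ∏ i, outLaw PX Q W (y i) ≤
        (2 : ℝ) ^ ((n : ℝ) * r₁) * ∏ i, PX (x i) * W (x i) (a i) (y i)
    · by_cases c₂ : ∏ _i : Fin n, (1 : ℝ) ≤ (2 : ℝ) ^ ((n : ℝ) * r₂) * ∏ i, W (x i) (a i) (y i)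
      · by_cases c₃ : ∏ _i : Fin n, (1 : ℝ) ≤
            (2 : ℝ) ^ ((n : ℝ) * r₃) * ∏ i, PX (x i) * W (x i) (a i) (y i)
        · rw [if_pos ⟨c₁, c₂, c₃⟩, if_neg c₁.not_gt, if_neg c₂.not_gt, if_neg c₃.not_gt]; norm_num
        · rw [if_neg (fun h => c₃ h.2.2), if_pos (lt_of_not_ge c₃)]
          split_ifs <;> norm_num
      · rw [if_neg (fun h => c₂ h.2.1), if_pos (lt_of_not_ge c₂)]
        split_ifs <;> norm_num
    · rw [if_neg (fun h => c₁ h.1), if_pos (lt_of_not_ge c₁)]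
      split_ifs <;> norm_num
  set M₁ := ⌊(2 : ℝ) ^ ((n : ℝ) * RX)⌋₊ with hM₁
  set M₂ := ⌊(2 : ℝ) ^ ((n : ℝ) * RY)⌋₊ with hM₂
  have hM₁' : 1 / (M₁ : ℝ) ≤ 2 * (2 : ℝ) ^ (-((n : ℝ) * RX)) := one_div_floor_le hRX n
  have hM₂' : 1 / (M₂ : ℝ) ≤ 2 * (2 : ℝ) ^ (-((n : ℝ) * RY)) := one_div_floor_le hRY n
  have hb₁ : (2 : ℝ) ^ ((n : ℝ) * r₁) * (1 / (M₁ : ℝ)) ≤ 2 * β₁ ^ n := by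
    calc _ ≤ (2 : ℝ) ^ ((n : ℝ) * r₁) * (2 * (2 : ℝ) ^ (-((n : ℝ) * RX))) := by gcongr
      _ = 2 * ((2 : ℝ) ^ ((n : ℝ) * r₁) * (2 : ℝ) ^ (-((n : ℝ) * RX))) := by ring
      _ = _ := by rw [rpow_mul_rpow_neg]
  have hb₂ : (2 : ℝ) ^ ((n : ℝ) * r₂) * (1 / (M₂ : ℝ)) ≤ 2 * β₂ ^ n := by
    calc _ ≤ (2 : ℝ) ^ ((n : ℝ) * r₂) * (2 * (2 : ℝ) ^ (-((n : ℝ) * RY))) := by gcongr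
      _ = 2 * ((2 : ℝ) ^ ((n : ℝ) * r₂) * (2 : ℝ) ^ (-((n : ℝ) * RY))) := by ring
      _ = _ := by rw [rpow_mul_rpow_neg]
  have hb₃ : (2 : ℝ) ^ ((n : ℝ) * r₃) * (1 / (M₁ : ℝ)) * (1 / (M₂ : ℝ)) ≤ 4 * β₃ ^ n := by
    calc _ ≤ (2 : ℝ) ^ ((n : ℝ) * r₃) * (2 * (2 : ℝ) ^ (-((n : ℝ) * RX))) *
          (2 * (2 : ℝ) ^ (-((n : ℝ) * RY))) := by gcongr
      _ = 4 * ((2 : ℝ) ^ ((n : ℝ) * r₃) *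
          ((2 : ℝ) ^ (-((n : ℝ) * RX)) * (2 : ℝ) ^ (-((n : ℝ) * RY)))) := by ring
      _ = 4 * ((2 : ℝ) ^ ((n : ℝ) * r₃) * (2 : ℝ) ^ (-((n : ℝ) * (RX + RY)))) := by
          rw [← Real.rpow_add two_pos]; ring_nf
      _ = _ := by rw [rpow_mul_rpow_neg]
  obtain ⟨b₁, b₂, h, dec, hc, hdec⟩ := exists_one_shot_code (sourceProb_mem hPX (n := n))
    (actionProb_mem hQ) (channelProb_mem hW) (T := T)
    (fun x a y => by simp only [hT]; split_ifs <;> simp)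
    (K₁ := (2 : ℝ) ^ ((n : ℝ) * r₁)) (K₂ := (2 : ℝ) ^ ((n : ℝ) * r₂))
    (K₃ := (2 : ℝ) ^ ((n : ℝ) * r₃))
    (fun x a y h => by
      rw [sum_prod_outLaw, sourceProb, channelProb, ← Finset.prod_mul_distrib]
      exact (hT1 x a y h).1)
    (fun x a y h => by simpa [channelProb] using (hT1 x a y h).2.1)
    (fun x a y h => by
      rw [sourceProb, channelProb, ← Finset.prod_mul_distrib]
      simpa using (hT1 x a y h).2.2)
    (hK _) (hK _) (hK _)
    -- Subtracting the lower bound `m` makes the cost nonnegative, as the averaging argument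
    -- requires.
    (Z := fun _ a => 1 / (n : ℝ) * ∑ i, (Λ (a i) - m))
    (fun _ a => mul_nonneg (by positivity) (Finset.sum_nonneg fun i _ => sub_nonneg.2 (hm _)))
    (floor_two_rpow_pos hRX n) (floor_two_rpow_pos hRY n) (t := Γ - m) (e := e n) hδ1
    (sub_nonneg.2 hΓ) (he0 n)
    (by
      rw [mean_action_cost hPX hQ (fun a => Λ a - m)]
      have h1 : ∑ x, ∑ a, PX x * Q x a * (Λ a - m) = ∑ ω, jointLaw PX Q W ω * Λ ω.2.1 - m := by
        rw [← sum_jointLaw_mul_eq hW fun _ a => Λ a - m]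
        simp_rw [mul_sub]
        rw [Finset.sum_sub_distrib, ← Finset.sum_mul, (jointLaw_mem hPX hQ hW).2, one_mul]
      rw [h1]
      rcases Nat.eq_zero_or_pos n with hn | hn
      · subst hn
        simpa using mul_nonneg (sub_nonneg.2 hδ1) (sub_nonneg.2 hΓ)
      · have : (n : ℝ) ≠ 0 := by exact_mod_cast hn.ne'
        rw [← mul_assoc, one_div_mul_cancel this, one_mul]
        exact hcost)
    (by
      have : δ * e n = ρ₁ ^ n + ρ₂ ^ n + ρ₃ ^ n + 2 * β₁ ^ n + 2 * β₂ ^ n + 4 * β₃ ^ n := by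
        simp only [he]; field_simp
      rw [this]
      linarith)
  refine ⟨⟨b₁, b₂, h, dec⟩, fun hn => ?_, hdec⟩
  have hn' : (n : ℝ) ≠ 0 := by exact_mod_cast (by omega : n ≠ 0)
  have h2 : ∀ x : Fin n → X, 1 / (n : ℝ) * ∑ i, (Λ (h x i) - m) =
      1 / (n : ℝ) * ∑ i, Λ (h x i) - m := by
    intro x
    rw [Finset.sum_sub_distrib, mul_sub]
    simp [hn']
  have h3 : ∑ x : Fin n → X, sourceProb PX x * (1 / (n : ℝ) * ∑ i, (Λ (h x i) - m)) =
      ∑ x : Fin n → X, sourceProb PX x * (1 / (n : ℝ) * ∑ i, Λ (h x i)) - m := by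
    rw [Finset.sum_congr rfl fun x _ => by rw [h2, mul_sub], Finset.sum_sub_distrib,
      ← Finset.sum_mul, (sourceProb_mem hPX).2, one_mul]
  rw [h3] at hc
  exact (sub_le_sub_iff_right m).1 hc

theorem mem_closure_achievable (hPX : PX ∈ stdSimplex ℝ X) (hW : ∀ x a, W x a ∈ stdSimplex ℝ Y)
    (Λ : A → ℝ) {Γ : ℝ} {r : ℝ × ℝ} (hr : (r.1, r.2, Γ) ∈ singleLetterTriplets PX W Λ) :
    r ∈ closure {r | Achievable PX W Λ Γ r} := by
  obtain ⟨Q, hQ, hc, h1, h2, hbX, hbY, hbS⟩ := (mem_singleLetterTriplets_iff hPX hW).1 hr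
  simp only at hc h1 h2 hbX hbY hbS
  have hXne : Nonempty X := nonempty_of_mem_stdSimplex hPX
  obtain ⟨x₀⟩ := hXne
  have hAne : Nonempty A := nonempty_of_mem_stdSimplex (hQ x₀)
  -- Always playing the cheapest action `a₀` serves as the perturbation that creates slack in the
  -- cost.
  obtain ⟨a₀, ha₀⟩ := Finite.exists_min Λ
  have hQ₀ : ∀ x : X, (fun _ : X => (Pi.single a₀ 1 : A → ℝ)) x ∈ stdSimplex ℝ A := fun _ =>
    single_mem_stdSimplex ℝ a₀
  have hcost₀ : ∑ ω, jointLaw PX (fun _ => Pi.single a₀ (1 : ℝ)) W ω * Λ ω.2.1 = Λ a₀ := by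
    rw [sum_jointLaw_mul_eq hW fun _ a => Λ a]
    simp [Pi.single_apply, ← Finset.sum_mul, hPX.2]
  have hge : Λ a₀ ≤ ∑ ω, jointLaw PX Q W ω * Λ ω.2.1 := by
    calc Λ a₀ = ∑ ω, jointLaw PX Q W ω * Λ a₀ := by
          rw [← Finset.sum_mul, (jointLaw_mem hPX hQ hW).2, one_mul]
      _ ≤ _ := Finset.sum_le_sum fun ω _ =>
          mul_le_mul_of_nonneg_left (ha₀ _) (jointLaw_nonneg hPX hQ hW ω)
  have hlim : Tendsto (fun η : ℝ => (r.1 + η, r.2 + η)) (𝓝[>] 0) (𝓝 r) := by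
    have h : Continuous fun η : ℝ => (r.1 + η, r.2 + η) := by fun_prop
    have := (h.tendsto 0).mono_left (nhdsWithin_le_nhds (s := Set.Ioi (0 : ℝ)))
    simpa using this
  refine mem_closure_of_tendsto hlim ?_
  filter_upwards [self_mem_nhdsWithin] with η hη
  have hη : 0 < η := hη
  -- Mixing scales the excess of the cost over its minimum by exactly 1 - δ, while by continuity the
  -- rate bounds stay below the rates increased by η for small δ.
  set Qδ : ℝ → X → A → ℝ := fun δ => (1 - δ) • Q + δ • fun _ => Pi.single a₀ (1 : ℝ) with hQδ
  have hcont : Continuous Qδ := by fun_prop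
  have hz : Qδ 0 = Q := by simp [hQδ]
  have hev : ∀ {f : (X → A → ℝ) → ℝ} {c : ℝ}, Continuous f → f Q < c →
      ∀ᶠ δ in 𝓝[>] (0 : ℝ), f (Qδ δ) < c := by
    intro f c hf hlt
    have := ((hf.comp hcont).tendsto 0).mono_left (nhdsWithin_le_nhds (s := Set.Ioi (0 : ℝ)))
    refine this.eventually_lt_const ?_
    simpa [hz] using hlt
  have e1 := hev (f := fun Q => rateBoundX PX Q W) (c := r.1 + η) continuous_rateBoundX
    (by linarith)
  have e2 := hev (f := fun Q => rateBoundY PX Q W) (c := r.2 + η)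
    (continuous_sum_jointLaw_mul _) (by linarith)
  have e3 := hev (f := fun Q => rateBoundSum PX Q W) (c := (r.1 + η) + (r.2 + η))
    (continuous_sum_jointLaw_mul _) (by linarith)
  have e4 : ∀ᶠ δ in 𝓝[>] (0 : ℝ), δ ∈ Set.Ioo (0 : ℝ) 1 := Ioo_mem_nhdsGT one_pos
  obtain ⟨δ, hX, hY, hS, hδ0, hδ1⟩ := (e1.and (e2.and (e3.and e4))).exists
  refine achievable_of_rateBounds_lt hPX
    (simplex_combo hQ hQ₀ (sub_nonneg.2 hδ1.le) hδ0.le (by ring)) hW ha₀ (hge.trans hc) hδ0 hδ1.le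
    ?_ (by positivity) (by positivity) hX hY hS
  rw [sum_jointLaw_mul_combo, hcost₀]
  nlinarith

end Achievability

/-! ### Converse -/

noncomputable section Converse

variable {X A Y : Type*} [Fintype X] [DecidableEq X] [Fintype A] [DecidableEq A]
  [Fintype Y] [DecidableEq Y] {PX : X → ℝ} {W : X → A → Y → ℝ}

/-- The time-averaged conditional law of the actions chosen by a block strategy. -/
theorem exists_averaged_action_law (hPX : PX ∈ stdSimplex ℝ X) {n : ℕ} (hn : 1 ≤ n)
    (h : (Fin n → X) → (Fin n → A)) : ∃ Q : X → A → ℝ, (∀ x, Q x ∈ stdSimplex ℝ A) ∧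
      ∀ F : X → A → ℝ, ∑ x, sourceProb PX x * ∑ i, F (x i) (h x i) =
        n * ∑ x, ∑ a, PX x * Q x a * F x a := by
  have hn0 : (n : ℝ) ≠ 0 := by exact_mod_cast (by omega : n ≠ 0)
  have hsp := sourceProb_mem hPX (n := n)
  obtain ⟨x₀⟩ : Nonempty X := nonempty_of_mem_stdSimplex hPX
  set a₀ : A := h (fun _ => x₀) ⟨0, hn⟩
  set ν : X → A → ℝ := fun x a => 1 / (n : ℝ) * ∑ z : Fin n → X, sourceProb PX z *
    ∑ i, (if z i = x then 1 else 0) * (if h z i = a then 1 else 0) with hν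
  have hν0 : ∀ x a, 0 ≤ ν x a := fun x a => mul_nonneg (by positivity)
    (Finset.sum_nonneg fun z _ => mul_nonneg (hsp.1 z) (Finset.sum_nonneg fun i _ => by positivity))
  -- The time average keeps the source marginal because every coordinate has law `PX`.
  have hνsum : ∀ x, ∑ a, ν x a = PX x := by
    intro x
    have h1 : ∑ a, ν x a = 1 / (n : ℝ) * ∑ z : Fin n → X, sourceProb PX z *
        ∑ i, if z i = x then 1 else 0 := by
      simp only [hν]
      rw [← Finset.mul_sum, Finset.sum_comm]
      congr 1
      refine Finset.sum_congr rfl fun z _ => ?_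
      rw [← Finset.mul_sum, Finset.sum_comm]
      simp
    rw [h1]
    unfold sourceProb
    rw [mean_sum_eval (q := fun _ : Fin n => PX) (fun _ => hPX.2)
      (fun _ b => if b = x then 1 else 0)]
    simp [hn0]
  have hνF : ∀ F : X → A → ℝ, ∑ x, sourceProb PX x * ∑ i, F (x i) (h x i) =
      n * ∑ x, ∑ a, ν x a * F x a := by
    intro F
    have h1 : ∀ x a, ν x a * F x a = 1 / (n : ℝ) * ∑ z : Fin n → X, sourceProb PX z *
        ∑ i, (if z i = x then 1 else 0) * ((if h z i = a then 1 else 0) * F x a) := by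
      intro x a
      simp only [hν]
      rw [mul_assoc, Finset.sum_mul]
      congr 1
      refine Finset.sum_congr rfl fun z _ => ?_
      rw [mul_assoc, Finset.sum_mul]
      congr 1
      exact Finset.sum_congr rfl fun i _ => by ring
    simp_rw [h1, ← Finset.mul_sum]
    rw [← mul_assoc, mul_one_div_cancel hn0, one_mul,
      Finset.sum_congr rfl fun x _ => Finset.sum_comm, Finset.sum_comm]
    refine Finset.sum_congr rfl fun z _ => ?_
    simp_rw [← Finset.mul_sum]
    congr 1
    rw [Finset.sum_congr rfl fun x _ => Finset.sum_comm, Finset.sum_comm]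
    refine Finset.sum_congr rfl fun i _ => ?_
    simp
  -- Where `PX x = 0` the conditional law is arbitrary; a point mass at `a₀` keeps it in the
  -- simplex.
  set Q : X → A → ℝ := fun x a =>
    if PX x = 0 then (Pi.single a₀ 1 : A → ℝ) a else ν x a / PX x with hQdef
  have hPQ : ∀ x a, PX x * Q x a = ν x a := by
    intro x a
    by_cases hx : PX x = 0
    · have h1 : ∑ a, ν x a = 0 := by rw [hνsum, hx]
      rw [hx, zero_mul, (Finset.sum_eq_zero_iff_of_nonneg fun a _ => hν0 x a).1 h1 a
        (Finset.mem_univ a)]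
    · simp only [hQdef, if_neg hx]; field_simp
  refine ⟨Q, fun x => ?_, fun F => ?_⟩
  · by_cases hx : PX x = 0
    · have : Q x = Pi.single a₀ 1 := by ext a; simp [hQdef, hx]
      rw [this]
      exact single_mem_stdSimplex ℝ a₀
    · refine ⟨fun a => ?_, ?_⟩
      · simp only [hQdef, if_neg hx]
        exact div_nonneg (hν0 x a) (hPX.1 x)
      · simp only [hQdef, if_neg hx]
        rw [← Finset.sum_div, hνsum, div_self hx]
  · simp_rw [hPQ]; exact hνF F

/-- The single-letterisation: an additive functional of a block sees only the averaged joint law. -/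
theorem sum_code_law (hW : ∀ x a, W x a ∈ stdSimplex ℝ Y) {n : ℕ}
    {h : (Fin n → X) → (Fin n → A)} {Q : X → A → ℝ}
    (hF : ∀ F : X → A → ℝ, ∑ x, sourceProb PX x * ∑ i, F (x i) (h x i) =
        n * ∑ x, ∑ a, PX x * Q x a * F x a) (φ : X × A × Y → ℝ) :
    ∑ z : (Fin n → X) × (Fin n → Y), sourceProb PX z.1 * channelProb W z.1 (h z.1) z.2 *
      ∑ i, φ (z.1 i, h z.1 i, z.2 i) = n * ∑ ω, jointLaw PX Q W ω * φ ω := by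
  rw [Fintype.sum_prod_type]
  have h1 : ∀ x : Fin n → X, ∑ y : Fin n → Y, sourceProb PX x * channelProb W x (h x) y *
      ∑ i, φ (x i, h x i, y i) =
      sourceProb PX x * ∑ i, ∑ b, W (x i) (h x i) b * φ (x i, h x i, b) := by
    intro x
    rw [← mean_sum_eval (q := fun i => W (x i) (h x i)) (fun _ => (hW _ _).2)
      (fun i b => φ (x i, h x i, b)), Finset.mul_sum]
    exact Finset.sum_congr rfl fun y _ => by rw [channelProb]; ring
  simp_rw [h1]
  rw [hF fun x a => ∑ b, W x a b * φ (x, a, b)]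
  simp_rw [Fintype.sum_prod_type, Finset.mul_sum, jointLaw, mul_assoc]

/-- The points of `D` carry at most half of the mass, and the background weight 1/(2K) the other
half. -/
theorem sum_two_level_le_one {B : Type*} [Fintype B] (D : B → Prop) [DecidablePred D] {M K : ℝ}
    (hM : ((Finset.univ.filter D).card : ℝ) ≤ M) (hM0 : 0 < M) (hK : (Fintype.card B : ℝ) ≤ K)
    (hK0 : 0 < K) : ∑ b, (if D b then 1 / (2 * M) else 1 / (2 * K)) ≤ 1 := by
  calc ∑ b, (if D b then 1 / (2 * M) else 1 / (2 * K))
      ≤ ∑ b, ((if D b then 1 / (2 * M) else 0) + 1 / (2 * K)) := by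
        refine Finset.sum_le_sum fun b _ => ?_
        have : 0 ≤ 1 / (2 * K) := by positivity
        split_ifs <;> linarith
    _ = (Finset.univ.filter D).card * (1 / (2 * M)) + Fintype.card B * (1 / (2 * K)) := by
        rw [Finset.sum_add_distrib, ← Finset.sum_filter]
        simp
    _ ≤ M * (1 / (2 * M)) + K * (1 / (2 * K)) := by gcongr
    _ = 1 := by field_simp; norm_num

/-- A Fano-type bound: Gibbs' inequality against the measure with density
`∏ b (xᵢ, aᵢ, yᵢ)` with respect to the two-level weight. -/
theorem block_converse_bound (hPX : PX ∈ stdSimplex ℝ X) (hW : ∀ x a, W x a ∈ stdSimplex ℝ Y)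
    {n : ℕ} {h : (Fin n → X) → (Fin n → A)} {Q : X → A → ℝ}
    (hF : ∀ F : X → A → ℝ, ∑ x, sourceProb PX x * ∑ i, F (x i) (h x i) =
        n * ∑ x, ∑ a, PX x * Q x a * F x a)
    (D : (Fin n → X) × (Fin n → Y) → Prop) [DecidablePred D] {M K : ℝ} (hM : 1 ≤ M) (hK : 1 ≤ K)
    {b : X × A × Y → ℝ} (hb : ∀ ω, 0 ≤ b ω) (hb' : ∀ ω, 0 < jointLaw PX Q W ω → 0 < b ω)
    (hsum : ∑ z : (Fin n → X) × (Fin n → Y), (∏ i, b (z.1 i, h z.1 i, z.2 i)) *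
      (if D z then 1 / (2 * M) else 1 / (2 * K)) ≤ 1) :
    n * ∑ ω, jointLaw PX Q W ω * (Real.logb 2 (b ω) - Real.logb 2 (PX ω.1 * W ω.1 ω.2.1 ω.2.2)) ≤
      1 + Real.logb 2 M + (∑ z : (Fin n → X) × (Fin n → Y),
        if D z then 0 else sourceProb PX z.1 * channelProb W z.1 (h z.1) z.2) * Real.logb 2 K := by
  set p : (Fin n → X) × (Fin n → Y) → ℝ :=
    fun z => sourceProb PX z.1 * channelProb W z.1 (h z.1) z.2 with hp
  set c : (Fin n → X) × (Fin n → Y) → ℝ :=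
    fun z => if D z then 1 / (2 * M) else 1 / (2 * K) with hc
  have hp0 : ∀ z, 0 ≤ p z := fun z =>
    mul_nonneg ((sourceProb_mem hPX).1 _) ((channelProb_mem hW _ _).1 _)
  have hp1 : ∑ z, p z = 1 := by
    rw [Fintype.sum_prod_type]
    simp only [hp]
    simp_rw [← Finset.mul_sum, (channelProb_mem hW _ _).2, mul_one]
    exact (sourceProb_mem hPX).2
  have hc0 : ∀ z, 0 < c z := fun z => by
    simp only [hc]; split_ifs <;> positivity
  have hfac : ∀ z, 0 < p z → ∀ i, 0 < PX (z.1 i) ∧ 0 < W (z.1 i) (h z.1 i) (z.2 i) ∧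
      0 < b (z.1 i, h z.1 i, z.2 i) := by
    intro z hz i
    have hs : sourceProb PX z.1 ≠ 0 := left_ne_zero_of_mul hz.ne'
    have hch : channelProb W z.1 (h z.1) z.2 ≠ 0 := right_ne_zero_of_mul hz.ne'
    have h1 : 0 < PX (z.1 i) :=
      (hPX.1 _).lt_of_ne' (Finset.prod_ne_zero_iff.1 hs i (Finset.mem_univ i))
    have h2 : 0 < W (z.1 i) (h z.1 i) (z.2 i) :=
      ((hW _ _).1 _).lt_of_ne' (Finset.prod_ne_zero_iff.1 hch i (Finset.mem_univ i))
    refine ⟨h1, h2, hb' _ ?_⟩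
    -- Testing `hF` on the indicator of the pair at position `i` shows that a pair used with
    -- positive probability has positive averaged probability.
    have h3 := hF fun x a => (if x = z.1 i then 1 else 0) * (if a = h z.1 i then 1 else 0)
    have h4 : ∑ x, ∑ a, PX x * Q x a *
        ((if x = z.1 i then 1 else 0) * (if a = h z.1 i then 1 else 0)) =
        PX (z.1 i) * Q (z.1 i) (h z.1 i) := by
      simp
    rw [h4] at h3
    have h5 : 0 < ∑ x, sourceProb PX x * ∑ j, (if x j = z.1 i then (1 : ℝ) else 0) *
        (if h x j = h z.1 i then 1 else 0) := by
      have hnn : ∀ x : Fin n → X, 0 ≤ sourceProb PX x * ∑ j, (if x j = z.1 i then (1 : ℝ) else 0) *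
          (if h x j = h z.1 i then 1 else 0) := fun x =>
        mul_nonneg ((sourceProb_mem hPX).1 x) (Finset.sum_nonneg fun j _ => by positivity)
      refine Finset.sum_pos' (fun x _ => hnn x) ⟨z.1, Finset.mem_univ _, ?_⟩
      refine mul_pos (((sourceProb_mem hPX).1 _).lt_of_ne' hs) ?_
      exact Finset.sum_pos' (fun j _ => by positivity) ⟨i, Finset.mem_univ _, by simp⟩
    rw [h3] at h5
    have h6 : 0 < PX (z.1 i) * Q (z.1 i) (h z.1 i) := pos_of_mul_pos_right h5 (Nat.cast_nonneg n)
    exact mul_pos h6 h2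
  have hgibbs := gibbs_inequality (p := p)
    (q := fun z => (∏ i, b (z.1 i, h z.1 i, z.2 i)) * c z) hp0
    (fun z => mul_nonneg (Finset.prod_nonneg fun i _ => hb _) (hc0 z).le)
    (fun z hz => mul_pos (Finset.prod_pos fun i _ => (hfac z hz i).2.2) (hc0 z))
    (by rw [hp1]; exact hsum)
  have hlog : ∑ z, p z * (Real.logb 2 ((∏ i, b (z.1 i, h z.1 i, z.2 i)) * c z) -
      Real.logb 2 (p z)) = ∑ z, p z * ((∑ i, (Real.logb 2 (b (z.1 i, h z.1 i, z.2 i)) -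
      Real.logb 2 (PX (z.1 i) * W (z.1 i) (h z.1 i) (z.2 i)))) + Real.logb 2 (c z)) := by
    refine sum_mul_congr_of_pos hp0 fun z hz => ?_
    have hf := hfac z hz
    have h1 : p z = ∏ i, PX (z.1 i) * W (z.1 i) (h z.1 i) (z.2 i) := by
      simp only [hp, sourceProb, channelProb, Finset.prod_mul_distrib]
    rw [h1, Real.logb_mul (Finset.prod_pos fun i _ => (hf i).2.2).ne' (hc0 z).ne',
      Real.logb_prod _ _ (fun i _ => (hf i).2.2.ne'),
      Real.logb_prod _ _ (fun i _ => (mul_pos (hf i).1 (hf i).2.1).ne'), Finset.sum_sub_distrib]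
    ring
  rw [hlog] at hgibbs
  simp_rw [mul_add] at hgibbs
  rw [Finset.sum_add_distrib] at hgibbs
  have hmain := sum_code_law hW hF
    fun ω => Real.logb 2 (b ω) - Real.logb 2 (PX ω.1 * W ω.1 ω.2.1 ω.2.2)
  simp only [hp] at hgibbs
  rw [hmain] at hgibbs
  have hM' : 0 ≤ Real.logb 2 M := Real.logb_nonneg one_lt_two hM
  -- A correctly decoded pair costs 1 + log M. Any other costs 1 + log K, to which the nonnegative
  -- log M is added.
  have hclog : ∀ z, -Real.logb 2 (c z) ≤ 1 + Real.logb 2 M +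
      (if D z then 0 else 1) * Real.logb 2 K := by
    intro z
    simp only [hc]
    split_ifs
    · rw [one_div, Real.logb_inv, Real.logb_mul two_ne_zero (by positivity)]
      simp
    · rw [one_div, Real.logb_inv, Real.logb_mul two_ne_zero (by positivity)]
      simp; linarith
  have hfin : -∑ z, p z * Real.logb 2 (c z) ≤ 1 + Real.logb 2 M +
      (∑ z, if D z then 0 else p z) * Real.logb 2 K := by
    calc -∑ z, p z * Real.logb 2 (c z) = ∑ z, p z * (-Real.logb 2 (c z)) := by
          rw [← Finset.sum_neg_distrib]; simp
      _ ≤ ∑ z, p z * (1 + Real.logb 2 M + (if D z then 0 else 1) * Real.logb 2 K) :=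
          Finset.sum_le_sum fun z _ => mul_le_mul_of_nonneg_left (hclog z) (hp0 z)
      _ = _ := by
          simp_rw [mul_add]
          rw [Finset.sum_add_distrib, Finset.sum_add_distrib, ← Finset.sum_mul, ← Finset.sum_mul,
            hp1, Finset.sum_mul]
          simp
  simp only [hp] at hfin
  linarith

theorem logb_floor_le {R : ℝ} {n : ℕ} (hpos : 0 < ⌊(2 : ℝ) ^ ((n : ℝ) * R)⌋₊) :
    Real.logb 2 (⌊(2 : ℝ) ^ ((n : ℝ) * R)⌋₊ : ℝ) ≤ n * R := by
  have h1 : (0 : ℝ) < ⌊(2 : ℝ) ^ ((n : ℝ) * R)⌋₊ := by exact_mod_cast hpos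
  rw [Real.logb_le_iff_le_rpow one_lt_two h1]
  exact Nat.floor_le (by positivity)

/-- ε is the Fano correction per letter: one bit over `n`, plus the error probability times the log
of the alphabet size. -/
theorem code_rates_mem_singleLetter (hPX : PX ∈ stdSimplex ℝ X)
    (hW : ∀ x a, W x a ∈ stdSimplex ℝ Y) {Λ : A → ℝ} {Γ RX RY : ℝ} {n : ℕ} (hn : 1 ≤ n)
    (c : ActionCode X A Y RX RY n) (hcost : c.expectedCost PX Λ ≤ Γ) {ε : ℝ}
    (hε : ε = 1 / (n : ℝ) +
      c.errorProb PX W * Real.logb 2 (Fintype.card X * Fintype.card Y)) :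
    (RX + ε, RY + ε, Γ) ∈ singleLetterTriplets PX W Λ := by
  classical
  have hn0 : (0 : ℝ) < n := by exact_mod_cast hn
  obtain ⟨x₀⟩ : Nonempty X := nonempty_of_mem_stdSimplex hPX
  set a₀ : A := c.strategy (fun _ => x₀) ⟨0, hn⟩
  obtain ⟨y₀⟩ : Nonempty Y := nonempty_of_mem_stdSimplex (hW x₀ a₀)
  have hcX : (1 : ℝ) ≤ Fintype.card X := by exact_mod_cast Fintype.card_pos_iff.2 ⟨x₀⟩
  have hcY : (1 : ℝ) ≤ Fintype.card Y := by exact_mod_cast Fintype.card_pos_iff.2 ⟨y₀⟩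
  obtain ⟨Q, hQ, hF⟩ := exists_averaged_action_law hPX hn c.strategy
  set M₁ := ⌊(2 : ℝ) ^ ((n : ℝ) * RX)⌋₊ with hM₁
  set M₂ := ⌊(2 : ℝ) ^ ((n : ℝ) * RY)⌋₊ with hM₂
  -- An encoder has values only if its message set is nonempty, which forces both rates to be
  -- nonnegative.
  have hM₁0 : 0 < M₁ := Fin.pos (c.enc₁ fun _ => x₀)
  have hM₂0 : 0 < M₂ := Fin.pos (c.enc₂ fun _ => y₀)
  have hM₁' : (1 : ℝ) ≤ M₁ := by exact_mod_cast hM₁0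
  have hM₂' : (1 : ℝ) ≤ M₂ := by exact_mod_cast hM₂0
  have hl₁ : Real.logb 2 (M₁ : ℝ) ≤ n * RX := logb_floor_le hM₁0
  have hl₂ : Real.logb 2 (M₂ : ℝ) ≤ n * RY := logb_floor_le hM₂0
  have hRX : 0 ≤ RX := nonneg_of_mul_nonneg_right
    ((Real.logb_nonneg one_lt_two hM₁').trans hl₁) hn0
  have hRY : 0 ≤ RY := nonneg_of_mul_nonneg_right
    ((Real.logb_nonneg one_lt_two hM₂').trans hl₂) hn0
  set L := Real.logb 2 (Fintype.card X * Fintype.card Y : ℝ) with hL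
  have hcXY : (1 : ℝ) ≤ Fintype.card X * Fintype.card Y := one_le_mul_of_one_le_of_one_le hcX hcY
  have hL0 : 0 ≤ L := Real.logb_nonneg one_lt_two hcXY
  set K : ℝ := (Fintype.card X * Fintype.card Y : ℝ) ^ n with hK
  have hK1 : 1 ≤ K := one_le_pow₀ hcXY
  have hlK : Real.logb 2 K = n * L := by rw [hK, Real.logb_pow]
  set D : (Fin n → X) × (Fin n → Y) → Prop := fun z => z = c.dec (c.enc₁ z.1, c.enc₂ z.2) with hD
  have hpe : (∑ z : (Fin n → X) × (Fin n → Y), if D z then 0 else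
      sourceProb PX z.1 * channelProb W z.1 (c.strategy z.1) z.2) = c.errorProb PX W := by
    rw [Fintype.sum_prod_type, ActionCode.errorProb]
    simp only [hD, ne_eq, ite_not]
  have hpe0 : 0 ≤ c.errorProb PX W := by
    rw [← hpe]
    refine Finset.sum_nonneg fun z _ => ?_
    split_ifs
    · exact le_rfl
    · exact mul_nonneg ((sourceProb_mem hPX).1 _) ((channelProb_mem hW _ _).1 _)
  have hε0 : 0 ≤ ε := by rw [hε]; positivity
  have hfac := fun ω => factors_pos_of_jointLaw_pos (ω := ω) hPX hQ hW
  have hscale : ∀ {B R l : ℝ}, n * B ≤ 1 + l + c.errorProb PX W * Real.logb 2 K →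
      l ≤ n * R → B ≤ R + ε := by
    intro B R l h1 h2
    have h3 : n * (R + ε) = n * R + 1 + c.errorProb PX W * (n * L) := by
      rw [hε]; field_simp; ring
    refine le_of_mul_le_mul_left ?_ hn0
    rw [h3]
    rw [hlK] at h1
    linarith
  have hcardX : (Fintype.card (Fin n → X) : ℝ) ≤ K := by
    rw [hK, mul_pow]
    simp only [Fintype.card_pi, Finset.prod_const, Finset.card_univ, Fintype.card_fin, Nat.cast_pow]
    exact le_mul_of_one_le_right (by positivity) (one_le_pow₀ hcY)
  have hcardY : (Fintype.card (Fin n → Y) : ℝ) ≤ K := by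
    rw [hK, mul_pow]
    simp only [Fintype.card_pi, Finset.prod_const, Finset.card_univ, Fintype.card_fin, Nat.cast_pow]
    exact le_mul_of_one_le_left (by positivity) (one_le_pow₀ hcX)
  have hcardXY : (Fintype.card ((Fin n → X) × (Fin n → Y)) : ℝ) ≤ K := by
    rw [hK, mul_pow]
    simp
  -- With `y` fixed, a correctly decoded `x` is recovered from its bin alone, so `enc₁` is injective
  -- on this fibre.
  have hDX : ∀ y, ((Finset.univ.filter fun x => D (x, y)).card : ℝ) ≤ M₁ := by
    intro y
    have h1 : (Finset.univ.filter fun x => D (x, y)).card ≤ (Finset.univ : Finset (Fin M₁)).card := by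
      refine Finset.card_le_card_of_injOn c.enc₁ (fun _ _ => Finset.mem_coe.2 (Finset.mem_univ _)) ?_
      intro x hx x' hx' hxx
      have h1 : (x, y) = c.dec (c.enc₁ x, c.enc₂ y) := by simpa [hD] using hx
      have h2 : (x', y) = c.dec (c.enc₁ x', c.enc₂ y) := by simpa [hD] using hx'
      rw [hxx, ← h2] at h1
      exact congrArg Prod.fst h1
    rw [Finset.card_univ, Fintype.card_fin] at h1
    exact_mod_cast h1
  have hDY : ∀ x, ((Finset.univ.filter fun y => D (x, y)).card : ℝ) ≤ M₂ := by
    intro x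
    have h1 : (Finset.univ.filter fun y => D (x, y)).card ≤ (Finset.univ : Finset (Fin M₂)).card := by
      refine Finset.card_le_card_of_injOn c.enc₂ (fun _ _ => Finset.mem_coe.2 (Finset.mem_univ _)) ?_
      intro y hy y' hy' hyy
      have h1 : (x, y) = c.dec (c.enc₁ x, c.enc₂ y) := by simpa [hD] using hy
      have h2 : (x, y') = c.dec (c.enc₁ x, c.enc₂ y') := by simpa [hD] using hy'
      rw [hyy, ← h2] at h1
      exact congrArg Prod.snd h1
    rw [Finset.card_univ, Fintype.card_fin] at h1
    exact_mod_cast h1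
  have hDXY : ((Finset.univ.filter D).card : ℝ) ≤ M₁ * M₂ := by
    have h1 : (Finset.univ.filter D).card ≤ (Finset.univ : Finset (Fin M₁ × Fin M₂)).card := by
      refine Finset.card_le_card_of_injOn (fun z => (c.enc₁ z.1, c.enc₂ z.2))
        (fun _ _ => Finset.mem_coe.2 (Finset.mem_univ _)) ?_
      intro z hz z' hz' hzz
      have h1 : z = c.dec (c.enc₁ z.1, c.enc₂ z.2) := by simpa [hD] using hz
      have h2 : z' = c.dec (c.enc₁ z'.1, c.enc₂ z'.2) := by simpa [hD] using hz'
      have h3 : (c.enc₁ z.1, c.enc₂ z.2) = (c.enc₁ z'.1, c.enc₂ z'.2) := hzz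
      rw [h1, h3, ← h2]
    rw [Finset.card_univ, Fintype.card_prod, Fintype.card_fin, Fintype.card_fin] at h1
    exact_mod_cast h1
  rw [mem_singleLetterTriplets_iff hPX hW]
  refine ⟨Q, hQ, ?_, by positivity, by positivity, ?_, ?_, ?_⟩
  · refine le_of_eq_of_le ?_ hcost
    rw [sum_jointLaw_mul_eq hW fun _ a => Λ a, ActionCode.expectedCost]
    have h1 := hF fun _ a => Λ a
    have h2 : ∑ x : Fin n → X, sourceProb PX x * (1 / (n : ℝ) * ∑ i, Λ (c.strategy x i)) =
        1 / (n : ℝ) * ∑ x : Fin n → X, sourceProb PX x * ∑ i, Λ (c.strategy x i) := by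
      rw [Finset.mul_sum]
      exact Finset.sum_congr rfl fun x _ => by ring
    rw [h2, h1, ← mul_assoc, one_div_mul_cancel hn0.ne', one_mul]
  · refine hscale (l := Real.logb 2 M₁) ?_ hl₁
    rw [← hpe]
    -- The density is the product of the averaged output law, so H(Y) of the averaged law appears at
    -- once and no concavity step is needed.
    refine block_converse_bound hPX hW hF D hM₁' hK1 (b := fun ω => outLaw PX Q W ω.2.2)
      (fun ω => outLaw_nonneg hPX hQ hW _) (fun ω hω => (hfac ω hω).2.2.2) ?_
    rw [Fintype.sum_prod_type, Finset.sum_comm]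
    calc _ ≤ ∑ y : Fin n → Y, ∏ i, outLaw PX Q W (y i) := by
          refine Finset.sum_le_sum fun y _ => ?_
          dsimp only
          rw [← Finset.mul_sum]
          exact mul_le_of_le_one_right (Finset.prod_nonneg fun i _ => outLaw_nonneg hPX hQ hW _)
            (sum_two_level_le_one (fun x => D (x, y)) (hDX y) (by positivity) hcardX (by positivity))
      _ = 1 := sum_pi_prod_eq_one (q := fun _ : Fin n => outLaw PX Q W)
          fun _ => sum_outLaw hPX hQ hW
  · refine hscale (l := Real.logb 2 M₂) ?_ hl₂
    rw [← hpe]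
    -- Writing 1/W as P_X / (P_X W) fits the general bound, with the source law as density.
    have h1 : rateBoundY PX Q W = ∑ ω, jointLaw PX Q W ω * (Real.logb 2 (PX ω.1) -
        Real.logb 2 (PX ω.1 * W ω.1 ω.2.1 ω.2.2)) := by
      refine sum_mul_congr_of_pos (jointLaw_nonneg hPX hQ hW) fun ω hω => ?_
      rw [Real.logb_mul (hfac ω hω).1.ne' (hfac ω hω).2.2.1.ne', Real.logb_one]
      ring
    rw [h1]
    refine block_converse_bound hPX hW hF D hM₂' hK1 (b := fun ω => PX ω.1)
      (fun ω => hPX.1 _) (fun ω hω => (hfac ω hω).1) ?_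
    rw [Fintype.sum_prod_type]
    calc _ ≤ ∑ x : Fin n → X, sourceProb PX x := by
          refine Finset.sum_le_sum fun x _ => ?_
          dsimp only
          rw [← Finset.mul_sum]
          exact mul_le_of_le_one_right (Finset.prod_nonneg fun i _ => hPX.1 _)
            (sum_two_level_le_one (fun y => D (x, y)) (hDY x) (by positivity) hcardY (by positivity))
      _ = 1 := (sourceProb_mem hPX).2
  -- One ε suffices here, although two are available.
  · have h1 : rateBoundSum PX Q W ≤ (RX + RY) + ε := by
      refine hscale (l := Real.logb 2 (M₁ * M₂)) ?_ ?_
      · rw [← hpe]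
        refine block_converse_bound hPX hW hF D (one_le_mul_of_one_le_of_one_le hM₁' hM₂') hK1
          (b := fun _ => 1) (fun ω => zero_le_one) (fun ω hω => one_pos) ?_
        simp only [Finset.prod_const_one, one_mul]
        exact sum_two_level_le_one D hDXY (by positivity) hcardXY (by positivity)
      · rw [Real.logb_mul (by positivity) (by positivity)]
        linarith
    simp only
    linarith

/-- The rates enlarged by the Fano correction lie in the set for every n ≥ 1; the correction
vanishes and the set is closed. -/
theorem achievable_mem_singleLetter (hPX : PX ∈ stdSimplex ℝ X)
    (hW : ∀ x a, W x a ∈ stdSimplex ℝ Y) {Λ : A → ℝ} {Γ : ℝ} {r : ℝ × ℝ}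
    (hr : Achievable PX W Λ Γ r) : (r.1, r.2, Γ) ∈ singleLetterTriplets PX W Λ := by
  obtain ⟨c, hcost, herr⟩ := hr
  set ε : ℕ → ℝ := fun n => 1 / (n : ℝ) +
    (c n).errorProb PX W * Real.logb 2 (Fintype.card X * Fintype.card Y) with hε
  have hlim : Tendsto ε atTop (𝓝 0) := by
    have := (tendsto_one_div_atTop_nhds_zero_nat (𝕜 := ℝ)).add
      (herr.mul_const (Real.logb 2 (Fintype.card X * Fintype.card Y)))
    rwa [zero_mul, add_zero] at this
  have hlim2 : Tendsto (fun n => (r.1 + ε n, r.2 + ε n, Γ)) atTop (𝓝 (r.1, r.2, Γ)) := by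
    have h : Continuous fun η : ℝ => (r.1 + η, r.2 + η, Γ) := by fun_prop
    have := (h.tendsto 0).comp hlim
    rwa [add_zero, add_zero] at this
  refine (isClosed_singleLetterTriplets hPX hW Λ).mem_of_tendsto hlim2 ?_
  filter_upwards [eventually_ge_atTop 1] with n hn
  exact code_rates_mem_singleLetter hPX hW hn (c n) (hcost n hn) rfl

theorem optimalRateRegion_eq_slice (hPX : PX ∈ stdSimplex ℝ X)
    (hW : ∀ x a, W x a ∈ stdSimplex ℝ Y) (Λ : A → ℝ) (Γ : ℝ) :
    optimalRateRegion PX W Λ Γ = {r : ℝ × ℝ | (r.1, r.2, Γ) ∈ singleLetterTriplets PX W Λ} := by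
  refine Set.Subset.antisymm (closure_minimal (convexHull_min
    (fun r hr => achievable_mem_singleLetter hPX hW hr) (convex_singleLetter_slice hPX hW Λ Γ))
    ((isClosed_singleLetterTriplets hPX hW Λ).preimage
      (f := fun r : ℝ × ℝ => (r.1, r.2, Γ)) (by fun_prop))) fun r hr => ?_
  exact closure_mono (subset_convexHull ℝ _) (mem_closure_achievable hPX hW Λ hr)

end Converse

/-! ### Conclusion: the region in triplet form and slice by slice -/

theorem theorem2 {X A Y : Type*} [Fintype X] [DecidableEq X] [Fintype A] [DecidableEq A]
    [Fintype Y] [DecidableEq Y]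
    (PX : X → ℝ) (hPX : PX ∈ stdSimplex ℝ X)
    (W : X → A → Y → ℝ) (hW : ∀ x a, W x a ∈ stdSimplex ℝ Y) (Λ : A → ℝ) :
    {t : ℝ × ℝ × ℝ | (t.1, t.2.1) ∈ optimalRateRegion PX W Λ t.2.2} =
        closure (singleLetterTriplets PX W Λ) ∧
      ∀ Γ : ℝ, optimalRateRegion PX W Λ Γ =
        closure {r : ℝ × ℝ | (r.1, r.2, Γ) ∈ singleLetterTriplets PX W Λ} := by
  have hclosed := isClosed_singleLetterTriplets hPX hW Λ
  refine ⟨?_, fun Γ => ?_⟩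
  · rw [hclosed.closure_eq]
    ext t
    simp [optimalRateRegion_eq_slice hPX hW]
  · rw [← optimalRateRegion_eq_slice hPX hW, optimalRateRegion, closure_closure]
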